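/- Let $n\ge p+1$. For $\theta\ge 0$ let $f(\cdot;\theta)$ be a probability density on $\mathbb{R}^p$, with $f(x;0)=(2\pi)^{-p/2}\exp(-\|x\|^2/2)$. For $a\in\mathbb{R}^p$ and $B\in GL(p)$ put $f_{a,B}(x;\theta)=|\det B|^{-1}f(B^{-1}(x-a);\theta)$, and let $X=(x_1,\dots,x_n)$ be an i.i.d. sample from $f_{a,B}(\cdot;\theta)$, whose law is denoted $P_{a,B,\theta}$. Write $P_0=P_{0,I,0}$. The group $\mathbb{R}^p\times GL(p)$ acts on samples by $x_i\mapsto a+Bx_i$ for all $i$. An invariant test is a measurable function $\varphi$ of $X$ with values in $[0,1]$ (the probability of rejection) that is invariant under this action. It is nonrandomized, with critical region $R$, if $\varphi=1_R$. It has level $\alpha$ if $E_{a,B,0}\varphi\le\alpha$ for all $(a,B)$. Fix $\theta_1>0$. An invariant test of level $\alpha$ is most powerful invariant at level $\alpha$ for testing $\theta=0$ against $\theta=\theta_1$ if, for all $(a,B)$, its power $E_{a,B,\theta_1}\varphi$ is at least that of every invariant test of level $\alpha$. Let $\bar x=\frac1n\sum_i x_i$ and $S=\frac1n\sum_i(x_i-\bar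 x)(x_i-\bar x)'$. When $S$ is positive definite let $T$ be its Cholesky root (lower triangular with positive diagonal, $S=TT'$), let $z_i=T^{-1}(x_i-\bar x)$, and $$\Lambda(X)=\frac{\int_{GL(p)}\int_{\mathbb{R}^p}\prod_{i=1}^n f(a+Bz_i;\theta_1)\,|\det B|^{n-p-1}\,da\,dB}{\int_{GL(p)}\int_{\mathbb{R}^p}\prod_{i=1}^n f(a+Bz_i;0)\,|\det B|^{n-p-1}\,da\,dB},$$ where $da$ and $dB$ are the Lebesgue measures of $\mathbb{R}^p$ and $\mathbb{R}^{p\times p}$. Regions defined through $\Lambda$ below consist of samples with $S$ positive definite. Then: (1) For Lebesgue-almost every $X$ the matrix $S$ is positive definite and the numerator of $\Lambda(X)$ is finite; whenever $S$ is positive definite, the denominator is positive and finite. (2) For every $k>0$ the test with critical region $\{\Lambda>k\}$ is most powerful invariant at the level $\alpha=P_0(\Lambda>k)$, and every most powerful invariant test at this level equals it Lebesgue-almost everywhere. (3) For every $\alpha\in(0,1)$ there are $k\ge 0$, with $k>0$ if $f(\cdot;\theta_1)$ is positive everywhere, and $\gamma\in[0,1]$ such that the test $1_{\{\Lambda>k\}}+\gamma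 1_{\{\Lambda=k\}}$ has size exactly $\alpha$ under $P_0$ and is most powerful invariant at level $\alpha$, and every most powerful invariant test at level $\alpha$ equals $1_{\{\Lambda>k\}}$ at Lebesgue-almost every $X$ not in $\{\Lambda=k\}$. -/

import Mathlib

open MeasureTheory
open scoped ENNReal Matrix

noncomputable section

/-- The density `(2π)^(-p/2) exp(-‖x‖²/2)` of the standard normal law on `ℝ^p`
(`‖x‖² = ∑ j, x j ^ 2` is the squared Euclidean norm). -/
def stdNormalDensity (p : ℕ) (x : Fin p → ℝ) : ℝ :=
  ((2 * Real.pi) ^ ((p : ℝ) / 2))⁻¹ * Real.exp (-(∑ j, x j ^ 2) / 2)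

/-- The member `f_{a,B}(x; θ) = |det B|⁻¹ f(B⁻¹(x - a); θ)` of the affine family generated by the
standard members `f(·; θ)`. -/
def affineDensity {p : ℕ} (f : ℝ → (Fin p → ℝ) → ℝ) (θ : ℝ) (a : Fin p → ℝ)
    (B : Matrix (Fin p) (Fin p) ℝ) (x : Fin p → ℝ) : ℝ :=
  |B.det|⁻¹ * f θ (B⁻¹ *ᵥ (x - a))

/-- The joint law of an i.i.d. sample `x_1, …, x_n` from the density `f_{a,B}(·; θ)`.
A sample is `X : Fin n → Fin p → ℝ`, with `X i` the `i`-th observation. -/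
def sampleLaw (n : ℕ) {p : ℕ} (f : ℝ → (Fin p → ℝ) → ℝ) (θ : ℝ) (a : Fin p → ℝ)
    (B : Matrix (Fin p) (Fin p) ℝ) : Measure (Fin n → Fin p → ℝ) :=
  Measure.pi fun _ : Fin n =>
    (volume : Measure (Fin p → ℝ)).withDensity fun x => ENNReal.ofReal (affineDensity f θ a B x)

/-- The action `(a, B) X = 1_n a' + X B'`, that is `x_i ↦ a + B x_i` for every `i`. -/
def affineAct {n p : ℕ} (a : Fin p → ℝ) (B : Matrix (Fin p) (Fin p) ℝ)
    (X : Fin n → Fin p → ℝ) : Fin n → Fin p → ℝ :=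
  fun i => a + B *ᵥ X i

/-- The sample mean vector. -/
def sampleMean {n p : ℕ} (X : Fin n → Fin p → ℝ) : Fin p → ℝ :=
  (n : ℝ)⁻¹ • ∑ i, X i

/-- The sample covariance matrix `S = n⁻¹ ∑ (x_i - x̄)(x_i - x̄)'`. -/
def sampleCov {n p : ℕ} (X : Fin n → Fin p → ℝ) : Matrix (Fin p) (Fin p) ℝ :=
  (n : ℝ)⁻¹ • ∑ i, Matrix.vecMulVec (X i - sampleMean X) (X i - sampleMean X)

/-- `T` is lower triangular with positive diagonal entries and `S = T T'`. -/
def IsCholeskyRoot {p : ℕ} (S T : Matrix (Fin p) (Fin p) ℝ) : Prop :=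
  (∀ i j, i < j → T i j = 0) ∧ (∀ i, 0 < T i i) ∧ S = T * Tᵀ

theorem exists_isCholeskyRoot {p : ℕ} {S : Matrix (Fin p) (Fin p) ℝ} (hS : S.PosDef) :
    ∃ T, IsCholeskyRoot S T := by
  set L := LDL.lower hS with hL
  have hLinv : IsUnit (LDL.lowerInv hS).det :=
    (Matrix.isUnit_iff_isUnit_det _).1 (isUnit_of_invertible (LDL.lowerInv hS))
  have hLdet : L.det ≠ 0 := by
    rw [hL, LDL.lower, Matrix.det_nonsing_inv]
    exact (hLinv.ringInverse).ne_zero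
  have htri' : (LDL.lowerInv hS).BlockTriangular OrderDual.toDual :=
    fun _ _ hij => LDL.lowerInv_triangular hS hij
  have htri : L.BlockTriangular OrderDual.toDual :=
    Matrix.blockTriangular_inv_of_blockTriangular htri'
  have hLii : ∀ i, L i i ≠ 0 := by
    have h := Matrix.det_of_lowerTriangular L htri
    rw [h] at hLdet
    exact fun i => Finset.prod_ne_zero_iff.1 hLdet i (Finset.mem_univ i)
  have hD : ∀ i, 0 < LDL.diagEntries hS i := by
    have h : (LDL.diag hS).PosDef := by
      rw [LDL.diag_eq_lowerInv_conj]
      exact hS.mul_mul_conjTranspose_same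
        (Matrix.vecMul_injective_of_isUnit (isUnit_of_invertible (LDL.lowerInv hS)))
    exact Matrix.posDef_diagonal_iff.1 h
  have hsgn : ∀ i, SignType.sign (L i i) ≠ 0 := fun i => sign_ne_zero.2 (hLii i)
  refine ⟨L * Matrix.diagonal fun i => (SignType.sign (L i i) : ℝ) *
    Real.sqrt (LDL.diagEntries hS i), ?_, ?_, ?_⟩
  · intro i j hij
    rw [Matrix.mul_diagonal, htri hij, zero_mul]
  · intro i
    rw [Matrix.mul_diagonal, ← mul_assoc, self_mul_sign]
    exact mul_pos (abs_pos.2 (hLii i)) (Real.sqrt_pos.2 (hD i))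
  · have h := LDL.lower_conj_diag hS
    rw [Matrix.conjTranspose_eq_transpose_of_trivial, ← hL] at h
    rw [Matrix.transpose_mul, Matrix.diagonal_transpose, Matrix.mul_assoc,
      ← Matrix.mul_assoc (Matrix.diagonal _) (Matrix.diagonal _), Matrix.diagonal_mul_diagonal,
      ← Matrix.mul_assoc]
    refine h.symm.trans ?_
    rw [LDL.diag]
    congr 3
    funext i
    rw [mul_mul_mul_comm, Real.mul_self_sqrt (hD i).le]
    rcases lt_or_gt_of_ne (hLii i) with hi | hi
    · simp [sign_neg hi]
    · simp [sign_pos hi]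

open Classical in
/-- The Cholesky root of a positive definite matrix (and `1` where there is none). -/
def choleskyRoot {p : ℕ} (S : Matrix (Fin p) (Fin p) ℝ) : Matrix (Fin p) (Fin p) ℝ :=
  if h : ∃ T, IsCholeskyRoot S T then h.choose else 1

theorem choleskyRoot_spec {p : ℕ} {S : Matrix (Fin p) (Fin p) ℝ} (hS : S.PosDef) :
    IsCholeskyRoot S (choleskyRoot S) := by
  have h := exists_isCholeskyRoot hS
  rw [choleskyRoot, dif_pos h]
  exact h.choose_spec

/-- The standardized observations `z_i = T⁻¹ (x_i - x̄)`, with `T` the Cholesky root of the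
sample covariance matrix. -/
def standardized {n p : ℕ} (X : Fin n → Fin p → ℝ) : Fin n → Fin p → ℝ :=
  fun i => (choleskyRoot (sampleCov X))⁻¹ *ᵥ (X i - sampleMean X)

/-- The integral `∫_{GL(p)} ∫_{ℝ^p} ∏ f(a + B z_i; θ) |det B|^(n-p-1) da dB`, a value in `[0, ∞]`;
`da` and `dB` are the Lebesgue measures of `ℝ^p` and of the space of `p × p` matrices. -/
def groupIntegral {n p : ℕ} (f : ℝ → (Fin p → ℝ) → ℝ) (θ : ℝ) (z : Fin n → Fin p → ℝ) : ℝ≥0∞ :=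
  ∫⁻ B in {B : Fin p → Fin p → ℝ | (Matrix.of B).det ≠ 0}, ∫⁻ a : Fin p → ℝ,
    ENNReal.ofReal ((∏ i, f θ (a + Matrix.of B *ᵥ z i)) *
      |(Matrix.of B).det| ^ ((n : ℤ) - (p : ℤ) - 1))

/-- The ratio of the integral at `θ₁` to the integral at `0`, at the standardized observations. -/
def invariantRatio {n p : ℕ} (f : ℝ → (Fin p → ℝ) → ℝ) (θ₁ : ℝ) (X : Fin n → Fin p → ℝ) : ℝ≥0∞ :=
  groupIntegral f θ₁ (standardized X) / groupIntegral f 0 (standardized X)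

/-- The critical region `ratio > k`, among the samples with nonsingular sample covariance matrix
(those for which the standardized observations exist). -/
def criticalRegion (n : ℕ) {p : ℕ} (f : ℝ → (Fin p → ℝ) → ℝ) (θ₁ k : ℝ) :
    Set (Fin n → Fin p → ℝ) :=
  {X | (sampleCov X).PosDef ∧ ENNReal.ofReal k < invariantRatio f θ₁ X}

/-- The boundary `ratio = k` of the critical region. -/
def boundaryRegion (n : ℕ) {p : ℕ} (f : ℝ → (Fin p → ℝ) → ℝ) (θ₁ k : ℝ) :
    Set (Fin n → Fin p → ℝ) :=
  {X | (sampleCov X).PosDef ∧ invariantRatio f θ₁ X = ENNReal.ofReal k}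

/-- An invariant (possibly randomized) test: a measurable function `φ` with values in `[0, 1]`,
the probability of rejection, that is invariant under the action of `ℝ^p × GL(p)`.
The nonrandomized invariant tests are the indicators of the measurable invariant regions. -/
structure IsInvariantTest {n p : ℕ} (φ : (Fin n → Fin p → ℝ) → ℝ) : Prop where
  measurable : Measurable φ
  nonneg : ∀ X, 0 ≤ φ X
  le_one : ∀ X, φ X ≤ 1
  invariant : ∀ (a : Fin p → ℝ) (B : Matrix (Fin p) (Fin p) ℝ), B.det ≠ 0 →
    ∀ X, φ (affineAct a B X) = φ X

/-- `φ` has level `α` for the null hypothesis `θ = 0`, whatever the nuisance parameter `(a, B)`. -/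
def HasLevel {n p : ℕ} (f : ℝ → (Fin p → ℝ) → ℝ) (α : ℝ) (φ : (Fin n → Fin p → ℝ) → ℝ) : Prop :=
  ∀ (a : Fin p → ℝ) (B : Matrix (Fin p) (Fin p) ℝ), B.det ≠ 0 →
    ∫ X, φ X ∂(sampleLaw n f 0 a B) ≤ α

/-- `φ` is a most powerful invariant test of level `α` for testing `θ = 0` against `θ = θ₁`:
an invariant test of level `α` whose power at `θ₁` is, for every value of the nuisance parameter
`(a, B)`, at least that of every other invariant test of level `α`. -/
structure IsMostPowerfulInvariant {n p : ℕ} (f : ℝ → (Fin p → ℝ) → ℝ) (θ₁ α : ℝ)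
    (φ : (Fin n → Fin p → ℝ) → ℝ) : Prop where
  isInvariantTest : IsInvariantTest φ
  hasLevel : HasLevel f α φ
  most_powerful : ∀ ψ : (Fin n → Fin p → ℝ) → ℝ, IsInvariantTest ψ → HasLevel f α ψ →
    ∀ (a : Fin p → ℝ) (B : Matrix (Fin p) (Fin p) ℝ), B.det ≠ 0 →
      ∫ X, ψ X ∂(sampleLaw n f θ₁ a B) ≤ ∫ X, φ X ∂(sampleLaw n f θ₁ a B)

end

/-! The laws for different (a, B) are images of one another under the group, so the size and the
power of an invariant test depend on θ alone. Once the likelihood ratio of the laws at θ₁ and 0 on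
invariant functions is known, the Neyman–Pearson lemma applies. That this ratio is Λ follows from an
averaging argument that never forms the quotient by the group.

Put J v(X) = ∫∫ v(a + BX) |det B|^(n-p-1) da dB (`orbitIntegral`) and L u(X) = ∫∫ u(B⁻¹(X - a)) |det
B|^(-p-1) da dB (`dualOrbitIntegral`), the latter an average over left Haar measure. The action on
samples has Jacobian |det B|^n, so J and L are adjoint (`lintegral_mul_orbitIntegral`). Moreover L u
is invariant, while J v changes along an orbit by a power of |det| that does not depend on v. With
v₀ the null density, u = v₀ / J v₀ and r = u / L u, adjointness yields ∫ h v = ∫ h r J v for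
invariant h (`exists_orbit_weight`). Using this for v and for v₀ gives ∫ h v = ∫ h (J v / J v₀) v₀
(`lintegral_invariant_mul`); h = 1 shows that J v is finite almost everywhere.

All this needs 0 < J v₀ < ∞, where normality enters: at a standardized sample ∑ ‖a + B z_i‖² = n‖a‖²
+ n‖B‖², so J v₀ is a Gaussian moment of |det B| (`orbitIntegral_stdNormal_ne_top`). Positivity of
the normal density also makes P₀-null sets Lebesgue-null, which puts uniqueness in its stated form.
-/

/-! ### Linear changes of variables and singular matrices -/

/-- A linear change of variables in a Lebesgue integral. -/
theorem lintegral_comp_linearMap {E : Type*} [NormedAddCommGroup E] [NormedSpace ℝ E]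
    [MeasurableSpace E] [BorelSpace E] [FiniteDimensional ℝ E] (μ : Measure E)
    [μ.IsAddHaarMeasure] {A : E →ₗ[ℝ] E} (hA : LinearMap.det A ≠ 0) {F : E → ℝ≥0∞}
    (hF : Measurable F) :
    ∫⁻ x, F (A x) ∂μ = ENNReal.ofReal |(LinearMap.det A)⁻¹| * ∫⁻ x, F x ∂μ := by
  have hAm : Measurable A := A.continuous_of_finiteDimensional.measurable
  rw [← lintegral_map hF hAm, Measure.map_linearMap_addHaar_eq_smul_addHaar μ hA,
    lintegral_smul_measure, smul_eq_mul]

/-- If a matrix valued map is shifted by multiples of the identity along a line, its values are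
almost everywhere nonsingular. -/
theorem ae_det_ne_zero_of_shift {E : Type*} [NormedAddCommGroup E] [NormedSpace ℝ E]
    [MeasurableSpace E] [BorelSpace E] [FiniteDimensional ℝ E] (μ : Measure E)
    [μ.IsAddHaarMeasure] {p : ℕ} (D : E → Matrix (Fin p) (Fin p) ℝ) (hD : Continuous D) (x₀ : E)
    (hshift : ∀ x (t : ℝ), D (x + t • x₀) = D x + t • (1 : Matrix (Fin p) (Fin p) ℝ)) :
    ∀ᵐ x ∂μ, (D x).det ≠ 0 := by
  have hmeas : MeasurableSet {q : E × ℝ | (D (q.1 + q.2 • x₀)).det ≠ 0} := by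
    have : Continuous fun q : E × ℝ => (D (q.1 + q.2 • x₀)).det :=
      (hD.comp (by fun_prop)).matrix_det
    exact (isOpen_ne_fun this continuous_const).measurableSet
  have h1 : ∀ᵐ x ∂μ, ∀ᵐ t : ℝ, (D (x + t • x₀)).det ≠ 0 := by
    refine Filter.Eventually.of_forall fun x => ?_
    -- On each line, singularity at `t` means that `t` is an eigenvalue of `-(D x)`.
    have hfin : {t : ℝ | (D (x + t • x₀)).det = 0}.Finite := by
      refine ((-(D x)).charpoly.roots.toFinset.finite_toSet).subset fun t ht => ?_
      rw [Finset.mem_coe, Multiset.mem_toFinset,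
        Polynomial.mem_roots (Matrix.charpoly_monic _).ne_zero, Polynomial.IsRoot,
        Matrix.eval_charpoly, sub_neg_eq_add, add_comm, Matrix.scalar_apply,
        ← Matrix.smul_one_eq_diagonal, ← hshift]
      exact ht
    rw [ae_iff]
    simpa using hfin.measure_zero volume
  -- By Fubini a single `t` serves almost every `x`; translation invariance of `μ` then removes the
  -- shift.
  obtain ⟨t, ht⟩ := ((Measure.ae_ae_comm hmeas).1 h1).exists
  have h2 := (measurePreserving_add_right μ (t • x₀)).quasiMeasurePreserving
  have h3 : ∀ᵐ x ∂(μ.map fun x => x + t • x₀), (D x).det ≠ 0 := by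
    rw [ae_map_iff (by fun_prop)]
    · exact ht
    · exact (isOpen_ne_fun hD.matrix_det continuous_const).measurableSet
  rwa [(measurePreserving_add_right μ (t • x₀)).map_eq] at h3

theorem ae_det_of_ne_zero (p : ℕ) : ∀ᵐ B : Fin p → Fin p → ℝ, (Matrix.of B).det ≠ 0 :=
  ae_det_ne_zero_of_shift volume (fun B => Matrix.of B) continuous_id
    (fun i j => (1 : Matrix (Fin p) (Fin p) ℝ) i j) fun _ _ => rfl

/-- Left multiplication by a matrix on the rows of a matrix of arbitrary height. -/
def mulVecRows {m p : ℕ} (B : Matrix (Fin p) (Fin p) ℝ) :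
    (Fin m → Fin p → ℝ) →ₗ[ℝ] (Fin m → Fin p → ℝ) :=
  LinearMap.pi fun i => (Matrix.toLin' B).comp (LinearMap.proj i)

theorem mulVecRows_apply {m p : ℕ} (B : Matrix (Fin p) (Fin p) ℝ) (X : Fin m → Fin p → ℝ) :
    mulVecRows B X = fun i => B *ᵥ X i := rfl

theorem det_mulVecRows {m p : ℕ} (B : Matrix (Fin p) (Fin p) ℝ) :
    LinearMap.det (mulVecRows (m := m) B) = B.det ^ m := by
  simp [mulVecRows, LinearMap.det_pi]

/-- The weight `|det B| ^ k`. -/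
noncomputable def detWeight {p : ℕ} (k : ℤ) (B : Matrix (Fin p) (Fin p) ℝ) : ℝ≥0∞ :=
  ENNReal.ofReal (|B.det| ^ k)

theorem detWeight_ne_top {p : ℕ} (k : ℤ) (B : Matrix (Fin p) (Fin p) ℝ) : detWeight k B ≠ ∞ :=
  ENNReal.ofReal_ne_top

theorem detWeight_ne_zero {p : ℕ} (k : ℤ) {B : Matrix (Fin p) (Fin p) ℝ} (hB : B.det ≠ 0) :
    detWeight k B ≠ 0 := by
  rw [detWeight, Ne, ENNReal.ofReal_eq_zero, not_le]
  positivity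

theorem detWeight_mul {p : ℕ} (k : ℤ) (B C : Matrix (Fin p) (Fin p) ℝ) :
    detWeight k (B * C) = detWeight k B * detWeight k C := by
  rw [detWeight, Matrix.det_mul, abs_mul, mul_zpow, ENNReal.ofReal_mul (by positivity)]
  rfl

theorem detWeight_add {p : ℕ} (j k : ℤ) {B : Matrix (Fin p) (Fin p) ℝ} (hB : B.det ≠ 0) :
    detWeight (j + k) B = detWeight j B * detWeight k B := by
  rw [detWeight, zpow_add₀ (abs_ne_zero.2 hB), ENNReal.ofReal_mul (by positivity)]
  rfl

theorem measurable_detWeight {p : ℕ} (k : ℤ) :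
    Measurable fun B : Fin p → Fin p → ℝ => detWeight k (Matrix.of B) := by
  have hc : Continuous fun B : Fin p → Fin p → ℝ => (Matrix.of B).det :=
    Continuous.matrix_det continuous_id
  have h : Measurable fun B : Fin p → Fin p → ℝ => (Matrix.of B).det := hc.measurable
  unfold detWeight
  have h2 : Measurable fun x : ℝ => x ^ k := by fun_prop
  exact (h2.comp h.abs).ennreal_ofReal

theorem lintegral_mulVecRows {m p : ℕ} {B : Matrix (Fin p) (Fin p) ℝ} (hB : B.det ≠ 0)
    {F : (Fin m → Fin p → ℝ) → ℝ≥0∞} (hF : Measurable F) :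
    ∫⁻ X : Fin m → Fin p → ℝ, F (fun i => B *ᵥ X i) = detWeight (-m) B * ∫⁻ X, F X := by
  have h : LinearMap.det (mulVecRows (m := m) B) ≠ 0 := by
    rw [det_mulVecRows]; exact pow_ne_zero _ hB
  have := lintegral_comp_linearMap volume h hF
  rw [det_mulVecRows] at this
  simpa [mulVecRows_apply, detWeight, abs_inv, abs_pow] using this

theorem lintegral_mulVec {p : ℕ} {B : Matrix (Fin p) (Fin p) ℝ} (hB : B.det ≠ 0)
    {F : (Fin p → ℝ) → ℝ≥0∞} (hF : Measurable F) :
    ∫⁻ x, F (B *ᵥ x) = detWeight (-1) B * ∫⁻ x, F x := by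
  have h : LinearMap.det (Matrix.toLin' B) ≠ 0 := by
    rwa [LinearMap.det_toLin']
  have := lintegral_comp_linearMap volume h hF
  simpa [detWeight, abs_inv] using this

/-- Change of variables `B ↦ B C` on square matrices. -/
theorem lintegral_matrix_mul_right {p : ℕ} {C : Matrix (Fin p) (Fin p) ℝ} (hC : C.det ≠ 0)
    {F : (Fin p → Fin p → ℝ) → ℝ≥0∞} (hF : Measurable F) :
    ∫⁻ B : Fin p → Fin p → ℝ, F (fun i j => (Matrix.of B * C) i j)
      = detWeight (-p) C * ∫⁻ B, F B := by
  -- The rows of `B C` are the rows of `B` with `Cᵀ` applied.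
  have h := lintegral_mulVecRows (m := p) (B := Cᵀ) (by rwa [Matrix.det_transpose]) hF
  have h2 : detWeight (-p) Cᵀ = detWeight (-p) C := by simp [detWeight]
  rw [h2] at h
  rw [← h]
  refine lintegral_congr fun B => congrArg F ?_
  funext i j
  simp [Matrix.mul_apply, Matrix.mulVec, dotProduct, mul_comm]

/-- Change of variables `B ↦ C B` on square matrices. -/
theorem lintegral_matrix_mul_left {p : ℕ} {C : Matrix (Fin p) (Fin p) ℝ} (hC : C.det ≠ 0)
    {F : (Fin p → Fin p → ℝ) → ℝ≥0∞} (hF : Measurable F) :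
    ∫⁻ B : Fin p → Fin p → ℝ, F (fun i j => (C * Matrix.of B) i j)
      = detWeight (-p) C * ∫⁻ B, F B := by
  -- `C B` applies `C` to the columns of `B`, so the map is the row action conjugated by
  -- transposition.
  let e : (Fin p → Fin p → ℝ) ≃ₗ[ℝ] (Fin p → Fin p → ℝ) :=
    (Matrix.transposeLinearEquiv (Fin p) (Fin p) ℝ ℝ)
  let A := (e : (Fin p → Fin p → ℝ) →ₗ[ℝ] (Fin p → Fin p → ℝ)) ∘ₗ mulVecRows C ∘ₗ
    (e.symm : (Fin p → Fin p → ℝ) →ₗ[ℝ] (Fin p → Fin p → ℝ))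
  have hA : LinearMap.det A = C.det ^ p := by
    rw [LinearMap.det_conj, det_mulVecRows]
  have h : LinearMap.det A ≠ 0 := by rw [hA]; exact pow_ne_zero _ hC
  have := lintegral_comp_linearMap volume h hF
  rw [hA] at this
  have h3 : detWeight (-p) C = ENNReal.ofReal |(C.det ^ p)⁻¹| := by
    simp [detWeight, abs_inv, abs_pow]
  rw [h3, ← this]
  rfl

/-! ### The affine action on samples -/

/-- The inverse `X ↦ B⁻¹ (X - a)` of the affine action. -/
noncomputable def affineInv {n p : ℕ} (a : Fin p → ℝ) (B : Matrix (Fin p) (Fin p) ℝ)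
    (X : Fin n → Fin p → ℝ) : Fin n → Fin p → ℝ :=
  fun i => B⁻¹ *ᵥ (X i - a)

theorem affineInv_affineAct {n p : ℕ} (a : Fin p → ℝ) {B : Matrix (Fin p) (Fin p) ℝ}
    (hB : B.det ≠ 0) (X : Fin n → Fin p → ℝ) : affineInv a B (affineAct a B X) = X := by
  funext i
  simp [affineInv, affineAct, Matrix.mulVec_mulVec, Matrix.nonsing_inv_mul _ (Ne.isUnit hB)]

theorem affineInv_eq_affineAct {n p : ℕ} (a : Fin p → ℝ) (B : Matrix (Fin p) (Fin p) ℝ)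
    (X : Fin n → Fin p → ℝ) : affineInv a B X = affineAct (-(B⁻¹ *ᵥ a)) B⁻¹ X := by
  funext i
  simp [affineInv, affineAct, Matrix.mulVec_sub]
  abel

theorem det_inv_ne_zero {p : ℕ} {B : Matrix (Fin p) (Fin p) ℝ} (hB : B.det ≠ 0) :
    B⁻¹.det ≠ 0 := by
  rw [Matrix.det_nonsing_inv]
  exact ((Ne.isUnit hB).ringInverse).ne_zero

theorem measurable_affineAct_uncurry (n p : ℕ) :
    Measurable fun q : (Fin n → Fin p → ℝ) × (Fin p → Fin p → ℝ) × (Fin p → ℝ) =>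
      affineAct q.2.2 (Matrix.of q.2.1) q.1 := by
  refine measurable_pi_lambda _ fun i => measurable_pi_lambda _ fun j => ?_
  simp only [affineAct, Pi.add_apply, Matrix.mulVec, dotProduct, Matrix.of_apply]
  fun_prop

theorem measurable_matrix_inv (p : ℕ) :
    Measurable fun B : Fin p → Fin p → ℝ => fun i j => ((Matrix.of B)⁻¹ : Matrix _ _ ℝ) i j := by
  refine measurable_pi_lambda _ fun i => measurable_pi_lambda _ fun j => ?_
  have hd : Continuous fun B : Fin p → Fin p → ℝ => (Matrix.of B).det :=
    Continuous.matrix_det continuous_id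
  have ha : Continuous fun B : Fin p → Fin p → ℝ => (Matrix.of B).adjugate i j :=
    Continuous.matrix_elem (Continuous.matrix_adjugate continuous_id) i j
  simp only [Matrix.inv_def, Ring.inverse_eq_inv', Matrix.smul_apply, smul_eq_mul]
  exact hd.measurable.inv.mul ha.measurable

theorem measurable_affineInv_uncurry (n p : ℕ) :
    Measurable fun q : (Fin n → Fin p → ℝ) × (Fin p → Fin p → ℝ) × (Fin p → ℝ) =>
      affineInv q.2.2 (Matrix.of q.2.1) q.1 := by
  refine measurable_pi_lambda _ fun i => measurable_pi_lambda _ fun j => ?_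
  have h := measurable_matrix_inv p
  simp only [affineInv, Matrix.mulVec, dotProduct, Pi.sub_apply]
  refine Finset.measurable_sum _ fun k _ => Measurable.mul ?_ (by fun_prop)
  exact ((measurable_pi_apply k).comp ((measurable_pi_apply j).comp h)).comp (by fun_prop)

theorem measurable_affineAct {n p : ℕ} (a : Fin p → ℝ) (B : Matrix (Fin p) (Fin p) ℝ) :
    Measurable (affineAct (n := n) a B) :=
  (measurable_affineAct_uncurry n p).comp
    (measurable_id.prodMk (measurable_const (a := ((fun i j => B i j : Fin p → Fin p → ℝ), a))))

theorem measurable_affineInv {n p : ℕ} (a : Fin p → ℝ) (B : Matrix (Fin p) (Fin p) ℝ) :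
    Measurable (affineInv (n := n) a B) := by
  rw [funext (affineInv_eq_affineAct (n := n) a B)]
  exact measurable_affineAct _ _

/-! ### The two orbit averages and their adjointness -/

/-- The Haar type average `∫ ∫ v (a + B X) |det B| ^ (n - p - 1) da dB`. -/
noncomputable def orbitIntegral {n p : ℕ} (v : (Fin n → Fin p → ℝ) → ℝ≥0∞)
    (X : Fin n → Fin p → ℝ) : ℝ≥0∞ :=
  ∫⁻ B : Fin p → Fin p → ℝ, ∫⁻ a : Fin p → ℝ,
    v (affineAct a (Matrix.of B) X) * detWeight ((n : ℤ) - p - 1) (Matrix.of B)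

/-- The dual average `∫ ∫ u (B⁻¹ (X - a)) |det B| ^ (-p - 1) da dB`. -/
noncomputable def dualOrbitIntegral {n p : ℕ} (u : (Fin n → Fin p → ℝ) → ℝ≥0∞)
    (X : Fin n → Fin p → ℝ) : ℝ≥0∞ :=
  ∫⁻ B : Fin p → Fin p → ℝ, ∫⁻ a : Fin p → ℝ,
    u (affineInv a (Matrix.of B) X) * detWeight (-(p : ℤ) - 1) (Matrix.of B)

section
variable {n p : ℕ}

theorem measurable_orbit_integrand {v : (Fin n → Fin p → ℝ) → ℝ≥0∞} (hv : Measurable v) (k : ℤ) :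
    Measurable fun q : (Fin n → Fin p → ℝ) × (Fin p → Fin p → ℝ) × (Fin p → ℝ) =>
      v (affineAct q.2.2 (Matrix.of q.2.1) q.1) * detWeight k (Matrix.of q.2.1) :=
  (hv.comp (measurable_affineAct_uncurry n p)).mul
    ((measurable_detWeight k).comp (measurable_fst.comp measurable_snd))

theorem measurable_dual_integrand {v : (Fin n → Fin p → ℝ) → ℝ≥0∞} (hv : Measurable v) (k : ℤ) :
    Measurable fun q : (Fin n → Fin p → ℝ) × (Fin p → Fin p → ℝ) × (Fin p → ℝ) =>
      v (affineInv q.2.2 (Matrix.of q.2.1) q.1) * detWeight k (Matrix.of q.2.1) :=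
  (hv.comp (measurable_affineInv_uncurry n p)).mul
    ((measurable_detWeight k).comp (measurable_fst.comp measurable_snd))

theorem orbitIntegral_eq_prod {v : (Fin n → Fin p → ℝ) → ℝ≥0∞} (hv : Measurable v)
    (X : Fin n → Fin p → ℝ) :
    orbitIntegral v X = ∫⁻ q : (Fin p → Fin p → ℝ) × (Fin p → ℝ),
      v (affineAct q.2 (Matrix.of q.1) X) * detWeight ((n : ℤ) - p - 1) (Matrix.of q.1) := by
  have h := (measurable_orbit_integrand hv ((n : ℤ) - p - 1)).comp (measurable_prodMk_left (x := X))
  exact (lintegral_prod _ h.aemeasurable).symm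

theorem dualOrbitIntegral_eq_prod {u : (Fin n → Fin p → ℝ) → ℝ≥0∞} (hu : Measurable u)
    (X : Fin n → Fin p → ℝ) :
    dualOrbitIntegral u X = ∫⁻ q : (Fin p → Fin p → ℝ) × (Fin p → ℝ),
      u (affineInv q.2 (Matrix.of q.1) X) * detWeight (-(p : ℤ) - 1) (Matrix.of q.1) := by
  have h := (measurable_dual_integrand hu (-(p : ℤ) - 1)).comp (measurable_prodMk_left (x := X))
  exact (lintegral_prod _ h.aemeasurable).symm

theorem measurable_orbitIntegral {v : (Fin n → Fin p → ℝ) → ℝ≥0∞} (hv : Measurable v) :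
    Measurable (orbitIntegral v) := by
  rw [funext (orbitIntegral_eq_prod hv)]
  exact (measurable_orbit_integrand hv _).lintegral_prod_right'

theorem measurable_dualOrbitIntegral {u : (Fin n → Fin p → ℝ) → ℝ≥0∞} (hu : Measurable u) :
    Measurable (dualOrbitIntegral u) := by
  rw [funext (dualOrbitIntegral_eq_prod hu)]
  exact (measurable_dual_integrand hu _).lintegral_prod_right'

theorem ae_det_prod_ne_zero (p : ℕ) :
    ∀ᵐ q : (Fin p → Fin p → ℝ) × (Fin p → ℝ), (Matrix.of q.1).det ≠ 0 :=
  Measure.quasiMeasurePreserving_fst.ae (ae_det_of_ne_zero p)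

theorem affineAct_affineAct (a c : Fin p → ℝ) (B C : Matrix (Fin p) (Fin p) ℝ)
    (X : Fin n → Fin p → ℝ) :
    affineAct a B (affineAct c C X) = affineAct (a + B *ᵥ c) (B * C) X := by
  funext i
  simp [affineAct, Matrix.mulVec_add, Matrix.mulVec_mulVec, add_assoc]

/-- Change of variables along the affine action. -/
theorem lintegral_affineAct (a : Fin p → ℝ) {B : Matrix (Fin p) (Fin p) ℝ} (hB : B.det ≠ 0)
    {F : (Fin n → Fin p → ℝ) → ℝ≥0∞} (hF : Measurable F) :
    ∫⁻ X, F (affineAct a B X) = detWeight (-n) B * ∫⁻ X, F X := by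
  have h := lintegral_mulVecRows (m := n) hB (F := fun X => F ((fun _ => a) + X))
    (hF.comp (measurable_const_add _))
  rw [lintegral_add_left_eq_self (fun X => F X)] at h
  exact h

/-- Substituting (a + Bc, BC) for (a, B) costs |det C|^(-p), and rewriting the weight costs |det
C|^(-(n-p-1)). The resulting factor is the same for every `v`, hence cancels in ratios. -/
theorem orbitIntegral_affineAct {v : (Fin n → Fin p → ℝ) → ℝ≥0∞} (hv : Measurable v)
    (c : Fin p → ℝ) {C : Matrix (Fin p) (Fin p) ℝ} (hC : C.det ≠ 0) (X : Fin n → Fin p → ℝ) :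
    orbitIntegral v (affineAct c C X) = detWeight (1 - n) C * orbitIntegral v X := by
  set k : ℤ := (n : ℤ) - p - 1 with hk
  set F : (Fin p → Fin p → ℝ) → ℝ≥0∞ := fun B =>
    ∫⁻ a : Fin p → ℝ, v (affineAct a (Matrix.of B) X) * detWeight k (Matrix.of B) with hFdef
  have hF : Measurable F :=
    ((measurable_orbit_integrand hv k).comp measurable_prodMk_left).lintegral_prod_right'
  have hinner : ∀ B : Fin p → Fin p → ℝ,
      ∫⁻ a : Fin p → ℝ, v (affineAct a (Matrix.of B) (affineAct c C X)) *
        detWeight k (Matrix.of B)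
        = detWeight (-k) C * F (fun i j => (Matrix.of B * C) i j) := by
    intro B
    have hw : detWeight k (Matrix.of B) = detWeight (-k) C * detWeight k (Matrix.of B * C) := by
      rw [detWeight_mul, mul_left_comm, ← detWeight_add _ _ hC, neg_add_cancel]
      simp [detWeight]
    simp only [affineAct_affineAct]
    rw [lintegral_add_right_eq_self
      (fun a => v (affineAct a (Matrix.of B * C) X) * detWeight k (Matrix.of B)), hFdef]
    simp only
    rw [← lintegral_const_mul' _ _ (detWeight_ne_top _ _)]
    refine lintegral_congr fun a => ?_
    rw [hw, mul_left_comm]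
    rfl
  rw [orbitIntegral, ← hk, lintegral_congr hinner,
    lintegral_const_mul' _ _ (detWeight_ne_top _ _), lintegral_matrix_mul_right hC hF, ← mul_assoc,
    ← detWeight_add _ _ hC]
  congr 2
  rw [hk]; ring

/-- The measure |det B|^(-p-1) da dB is left Haar measure of the affine group: it is preserved by
(a, B) ↦ (c + Ca, CB), the two Jacobians being |det C| and |det C|^p. -/
theorem dualOrbitIntegral_affineAct {u : (Fin n → Fin p → ℝ) → ℝ≥0∞} (hu : Measurable u)
    (c : Fin p → ℝ) {C : Matrix (Fin p) (Fin p) ℝ} (hC : C.det ≠ 0) (X : Fin n → Fin p → ℝ) :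
    dualOrbitIntegral u (affineAct c C X) = dualOrbitIntegral u X := by
  set k : ℤ := -(p : ℤ) - 1 with hk
  set F : (Fin p → Fin p → ℝ) → ℝ≥0∞ := fun B =>
    ∫⁻ a : Fin p → ℝ, u (affineInv a (Matrix.of B) (affineAct c C X)) *
      detWeight k (Matrix.of B) with hFdef
  have hF : Measurable F :=
    ((measurable_dual_integrand hu k).comp measurable_prodMk_left).lintegral_prod_right'
  have hone : detWeight 0 C = 1 := by simp [detWeight]
  have hinner : ∀ B : Fin p → Fin p → ℝ, F (fun i j => (C * Matrix.of B) i j)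
      = detWeight (-p) C * ∫⁻ a : Fin p → ℝ, u (affineInv a (Matrix.of B) X) *
        detWeight k (Matrix.of B) := by
    intro B
    have hm : Measurable fun a : Fin p → ℝ => u (affineInv a (C * Matrix.of B) (affineAct c C X)) *
        detWeight k (C * Matrix.of B) :=
      (measurable_dual_integrand hu k).comp (f := fun a : Fin p → ℝ =>
        (affineAct c C X, ((fun i j => (C * Matrix.of B) i j : Fin p → Fin p → ℝ), a)))
        (by fun_prop)
    have h1 := lintegral_mulVec hC (F := fun a => u (affineInv (c + a) (C * Matrix.of B)
      (affineAct c C X)) * detWeight k (C * Matrix.of B)) (hm.comp (measurable_const_add c))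
    rw [lintegral_add_left_eq_self (fun a => u (affineInv a (C * Matrix.of B)
      (affineAct c C X)) * detWeight k (C * Matrix.of B)) c] at h1
    -- In the group, ((c, C)(a, B))⁻¹ (c, C) = (a, B)⁻¹.
    have h2 : ∀ a : Fin p → ℝ, affineInv (c + C *ᵥ a) (C * Matrix.of B) (affineAct c C X)
        = affineInv a (Matrix.of B) X := by
      intro a
      funext i
      simp only [affineInv, affineAct, Matrix.mul_inv_rev, add_sub_add_left_eq_sub,
        ← Matrix.mulVec_sub, Matrix.mulVec_mulVec, Matrix.mul_assoc,
        Matrix.nonsing_inv_mul _ (Ne.isUnit hC), Matrix.mul_one]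
    simp only [h2] at h1
    have h3 : F (fun i j => (C * Matrix.of B) i j) = ∫⁻ a : Fin p → ℝ,
      u (affineInv a (C * Matrix.of B) (affineAct c C X)) * detWeight k (C * Matrix.of B) := rfl
    have h4 : detWeight 1 C * (detWeight (-1) C * ∫⁻ a : Fin p → ℝ,
      u (affineInv a (C * Matrix.of B) (affineAct c C X)) * detWeight k (C * Matrix.of B))
      = ∫⁻ a : Fin p → ℝ,
      u (affineInv a (C * Matrix.of B) (affineAct c C X)) * detWeight k (C * Matrix.of B) := by
      rw [← mul_assoc, ← detWeight_add _ _ hC]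
      simp [hone]
    rw [h3, ← h4, ← h1]
    rw [← lintegral_const_mul' _ _ (detWeight_ne_top _ _),
      ← lintegral_const_mul' _ _ (detWeight_ne_top _ _)]
    refine lintegral_congr fun a => ?_
    rw [detWeight_mul, mul_left_comm (u _), ← mul_assoc, ← detWeight_add _ _ hC]
    congr 2
    rw [hk]; ring
  have h5 := lintegral_matrix_mul_left hC hF
  rw [lintegral_congr hinner, lintegral_const_mul' _ _ (detWeight_ne_top _ _)] at h5
  exact ((ENNReal.mul_right_inj (detWeight_ne_zero _ hC) (detWeight_ne_top _ _)).1 h5).symm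

/-- Adjointness for a single group element. The Jacobian |det B|^(-n) of the action on n
observations accounts for the difference between the two exponents. -/
theorem lintegral_mul_affineAct {u v : (Fin n → Fin p → ℝ) → ℝ≥0∞} (hu : Measurable u)
    (hv : Measurable v) (a : Fin p → ℝ) (B : Fin p → Fin p → ℝ) (hB : (Matrix.of B).det ≠ 0) :
    ∫⁻ X, u X * (v (affineAct a (Matrix.of B) X) * detWeight ((n : ℤ) - p - 1) (Matrix.of B))
      = ∫⁻ X, v X * (u (affineInv a (Matrix.of B) X) *
        detWeight (-(p : ℤ) - 1) (Matrix.of B)) := by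
  have hm : Measurable fun X : Fin n → Fin p → ℝ => u (affineInv a (Matrix.of B) X) :=
    hu.comp (measurable_affineInv a (Matrix.of B))
  have h := lintegral_affineAct (n := n) a hB
    (F := fun X => u (affineInv a (Matrix.of B) X) * v X) (hm.mul hv)
  simp only [affineInv_affineAct a hB] at h
  have e1 : ∀ X : Fin n → Fin p → ℝ, u X * (v (affineAct a (Matrix.of B) X) *
      detWeight ((n : ℤ) - p - 1) (Matrix.of B)) = detWeight ((n : ℤ) - p - 1) (Matrix.of B) *
      (u X * v (affineAct a (Matrix.of B) X)) := fun X => by ring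
  have e2 : ∀ X : Fin n → Fin p → ℝ, v X * (u (affineInv a (Matrix.of B) X) *
      detWeight (-(p : ℤ) - 1) (Matrix.of B)) = detWeight (-(p : ℤ) - 1) (Matrix.of B) *
      (u (affineInv a (Matrix.of B) X) * v X) := fun X => by ring
  rw [lintegral_congr e1, lintegral_congr e2, lintegral_const_mul' _ _ (detWeight_ne_top _ _),
    lintegral_const_mul' _ _ (detWeight_ne_top _ _), h, ← mul_assoc, ← detWeight_add _ _ hB]
  congr 2
  ring

/-- The two averages are adjoint to each other. -/
theorem lintegral_mul_orbitIntegral {u v : (Fin n → Fin p → ℝ) → ℝ≥0∞} (hu : Measurable u)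
    (hv : Measurable v) :
    ∫⁻ X, u X * orbitIntegral v X = ∫⁻ X, v X * dualOrbitIntegral u X := by
  have hl : ∀ X, u X * orbitIntegral v X = ∫⁻ q : (Fin p → Fin p → ℝ) × (Fin p → ℝ),
      u X * (v (affineAct q.2 (Matrix.of q.1) X) *
        detWeight ((n : ℤ) - p - 1) (Matrix.of q.1)) := by
    intro X
    rw [orbitIntegral_eq_prod hv]
    exact (lintegral_const_mul _ ((measurable_orbit_integrand hv _).comp
      (measurable_prodMk_left (x := X)))).symm
  have hr : ∀ X, v X * dualOrbitIntegral u X = ∫⁻ q : (Fin p → Fin p → ℝ) × (Fin p → ℝ),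
      v X * (u (affineInv q.2 (Matrix.of q.1) X) *
        detWeight (-(p : ℤ) - 1) (Matrix.of q.1)) := by
    intro X
    rw [dualOrbitIntegral_eq_prod hu]
    exact (lintegral_const_mul _ ((measurable_dual_integrand hu _).comp
      (measurable_prodMk_left (x := X)))).symm
  have hml := ((hu.comp measurable_fst).mul
    (measurable_orbit_integrand hv ((n : ℤ) - p - 1))).aemeasurable
      (μ := (volume : Measure (Fin n → Fin p → ℝ)).prod
        (volume : Measure ((Fin p → Fin p → ℝ) × (Fin p → ℝ))))
  have hmr := ((hv.comp measurable_fst).mul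
    (measurable_dual_integrand hu (-(p : ℤ) - 1))).aemeasurable
      (μ := (volume : Measure (Fin n → Fin p → ℝ)).prod
        (volume : Measure ((Fin p → Fin p → ℝ) × (Fin p → ℝ))))
  calc ∫⁻ X, u X * orbitIntegral v X
      = ∫⁻ q : (Fin p → Fin p → ℝ) × (Fin p → ℝ), ∫⁻ X : Fin n → Fin p → ℝ,
        u X * (v (affineAct q.2 (Matrix.of q.1) X) *
        detWeight ((n : ℤ) - p - 1) (Matrix.of q.1)) := by
        rw [lintegral_congr hl]
        exact lintegral_lintegral_swap hml
    _ = ∫⁻ q : (Fin p → Fin p → ℝ) × (Fin p → ℝ), ∫⁻ X : Fin n → Fin p → ℝ,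
        v X * (u (affineInv q.2 (Matrix.of q.1) X) *
        detWeight (-(p : ℤ) - 1) (Matrix.of q.1)) :=
        lintegral_congr_ae ((ae_det_prod_ne_zero p).mono fun q hq =>
          lintegral_mul_affineAct hu hv q.2 q.1 hq)
    _ = ∫⁻ X, v X * dualOrbitIntegral u X := by
        rw [lintegral_congr hr]
        exact (lintegral_lintegral_swap hmr).symm

end

/-! ### The likelihood ratio on invariant functions -/

/-- Invariance of a statistic under the affine group. -/
def IsAffineInvariant {n p : ℕ} {β : Type*} (h : (Fin n → Fin p → ℝ) → β) : Prop :=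
  ∀ (a : Fin p → ℝ) (B : Matrix (Fin p) (Fin p) ℝ), B.det ≠ 0 → ∀ X, h (affineAct a B X) = h X

section
variable {n p : ℕ}

theorem IsAffineInvariant.affineInv {β : Type*} {h : (Fin n → Fin p → ℝ) → β}
    (hh : IsAffineInvariant h) (a : Fin p → ℝ) {B : Matrix (Fin p) (Fin p) ℝ} (hB : B.det ≠ 0)
    (X : Fin n → Fin p → ℝ) : h (affineInv a B X) = h X := by
  rw [affineInv_eq_affineAct, hh _ _ (det_inv_ne_zero hB)]

/-- On the orbit of `X` the factor `h` is the constant `h X`, apart from the null set of singular B.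
-/
theorem dualOrbitIntegral_mul {h u : (Fin n → Fin p → ℝ) → ℝ≥0∞} (hh : IsAffineInvariant h)
    (hu : Measurable u) (X : Fin n → Fin p → ℝ) :
    dualOrbitIntegral (fun Y => h Y * u Y) X = h X * dualOrbitIntegral u X := by
  rw [dualOrbitIntegral_eq_prod hu]
  have hm := (measurable_dual_integrand hu (-(p : ℤ) - 1)).comp (measurable_prodMk_left (x := X))
  refine Eq.trans ?_ (lintegral_const_mul (h X) hm)
  have hm2 : ∀ᵐ B : Fin p → Fin p → ℝ, ∫⁻ a : Fin p → ℝ,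
      h (_root_.affineInv a (Matrix.of B) X) * u (_root_.affineInv a (Matrix.of B) X) *
        detWeight (-(p : ℤ) - 1) (Matrix.of B) = ∫⁻ a : Fin p → ℝ, h X *
      (u (_root_.affineInv a (Matrix.of B) X) * detWeight (-(p : ℤ) - 1) (Matrix.of B)) := by
    refine (ae_det_of_ne_zero p).mono fun B hB => lintegral_congr fun a => ?_
    rw [hh.affineInv a hB, mul_assoc]
  refine (lintegral_congr_ae hm2).trans ?_
  exact (lintegral_prod _ (hm.const_mul (h X)).aemeasurable).symm

theorem ae_neBot_matrix_prod (p : ℕ) :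
    (ae (volume : Measure ((Fin p → Fin p → ℝ) × (Fin p → ℝ)))).NeBot := by
  rw [ae_neBot, ← Measure.measure_univ_ne_zero, Measure.volume_eq_prod, ← Set.univ_prod_univ,
    Measure.prod_prod]
  exact mul_ne_zero (Measure.measure_univ_ne_zero.2 (NeZero.ne _))
    (Measure.measure_univ_ne_zero.2 (NeZero.ne _))

/-- There is a weight turning integrals of invariant functions into integrals against
orbit averages. -/
theorem exists_orbit_weight {v₀ : (Fin n → Fin p → ℝ) → ℝ≥0∞} (hv₀ : Measurable v₀)
    (hpos : ∀ X, v₀ X ≠ 0) (hfin : ∫⁻ X, v₀ X ≠ ∞)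
    (hJ : ∀ᵐ X, orbitIntegral v₀ X ≠ 0 ∧ orbitIntegral v₀ X ≠ ∞) :
    ∃ r : (Fin n → Fin p → ℝ) → ℝ≥0∞, Measurable r ∧ (∀ᵐ X, r X ≠ 0) ∧
      ∀ h v : (Fin n → Fin p → ℝ) → ℝ≥0∞, Measurable h → IsAffineInvariant h → Measurable v →
        ∫⁻ X, h X * v X = ∫⁻ X, h X * r X * orbitIntegral v X := by
  -- Chosen so that `u * orbitIntegral v₀ = v₀` almost everywhere; adjointness then bounds the
  -- integral of `v₀ * dualOrbitIntegral u` by that of `v₀`, and `v₀` has no zeros.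
  set u : (Fin n → Fin p → ℝ) → ℝ≥0∞ := fun X => v₀ X / orbitIntegral v₀ X with hu_def
  have hJm := measurable_orbitIntegral hv₀
  have hu : Measurable u := hv₀.div hJm
  have hLm := measurable_dualOrbitIntegral hu
  have hLinv : IsAffineInvariant (dualOrbitIntegral u) := fun a B hB X =>
    dualOrbitIntegral_affineAct hu a hB X
  have hLtop : ∀ᵐ X, dualOrbitIntegral u X ≠ ∞ := by
    have h1 : ∫⁻ X, v₀ X * dualOrbitIntegral u X ≠ ∞ := by
      rw [← lintegral_mul_orbitIntegral hu hv₀]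
      have : ∫⁻ X, u X * orbitIntegral v₀ X = ∫⁻ X, v₀ X :=
        lintegral_congr_ae (hJ.mono fun X hX => ENNReal.div_mul_cancel hX.1 hX.2)
      rwa [this]
    refine (ae_lt_top (hv₀.mul hLm) h1).mono fun X hX htop => ?_
    rw [Pi.mul_apply, htop, ENNReal.mul_top (hpos X)] at hX
    exact lt_irrefl _ hX
  -- If the average vanished, `u` would vanish at almost all points of the orbit. But `u` vanishes
  -- only where `orbitIntegral v₀` is infinite, and finiteness at `X` extends to the whole orbit.
  have hLpos : ∀ᵐ X, dualOrbitIntegral u X ≠ 0 := by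
    refine hJ.mono fun X hX h0 => ?_
    rw [dualOrbitIntegral_eq_prod hu] at h0
    have hm := (measurable_dual_integrand hu (-(p : ℤ) - 1)).comp (measurable_prodMk_left (x := X))
    have h1 := (lintegral_eq_zero_iff hm).1 h0
    have h2 : ∀ᵐ q : (Fin p → Fin p → ℝ) × (Fin p → ℝ), False := by
      filter_upwards [h1, ae_det_prod_ne_zero p] with q hq hdet
      have hq' : u (affineInv q.2 (Matrix.of q.1) X) *
        detWeight (-(p : ℤ) - 1) (Matrix.of q.1) = 0 := hq
      rcases mul_eq_zero.1 hq' with h3 | h3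
      · rw [hu_def] at h3
        rcases ENNReal.div_eq_zero_iff.1 h3 with h4 | h4
        · exact hpos _ h4
        · rw [affineInv_eq_affineAct, orbitIntegral_affineAct hv₀ _ (det_inv_ne_zero hdet)] at h4
          exact ENNReal.mul_ne_top (detWeight_ne_top _ _) hX.2 h4
      · exact detWeight_ne_zero _ hdet h3
    exact (@Filter.Eventually.exists _ _ _ (ae_neBot_matrix_prod p) h2).elim fun _ h => h
  refine ⟨fun X => (dualOrbitIntegral u X)⁻¹ * u X, hLm.inv.mul hu, ?_, ?_⟩
  · filter_upwards [hJ, hLtop] with X hX hL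
    exact mul_ne_zero (ENNReal.inv_ne_zero.2 hL) (ENNReal.div_ne_zero.2 ⟨hpos X, hX.2⟩)
  · intro h v hh hhinv hv
    have hkinv : IsAffineInvariant fun X => h X * (dualOrbitIntegral u X)⁻¹ := fun a B hB X => by
      simp only [hhinv a B hB X, hLinv a B hB X]
    have hkm : Measurable fun X => h X * (dualOrbitIntegral u X)⁻¹ := hh.mul hLm.inv
    -- The invariant factor leaves the dual average, and the dual average of `u` that remains
    -- cancels its own inverse.
    have h1 := lintegral_mul_orbitIntegral
      (u := fun X => h X * (dualOrbitIntegral u X)⁻¹ * u X) (hkm.mul hu) hv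
    simp only [dualOrbitIntegral_mul hkinv hu] at h1
    simp only [← mul_assoc]
    rw [h1]
    refine lintegral_congr_ae ?_
    filter_upwards [hLpos, hLtop] with X h3 h4
    rw [mul_assoc, ENNReal.inv_mul_cancel h3 h4, mul_one, mul_comm]

/-- Orbit averages of integrable functions are finite almost everywhere. -/
theorem orbitIntegral_ae_ne_top {v₀ v : (Fin n → Fin p → ℝ) → ℝ≥0∞} (hv₀ : Measurable v₀)
    (hpos : ∀ X, v₀ X ≠ 0) (hfin : ∫⁻ X, v₀ X ≠ ∞)
    (hJ : ∀ᵐ X, orbitIntegral v₀ X ≠ 0 ∧ orbitIntegral v₀ X ≠ ∞)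
    (hv : Measurable v) (hvfin : ∫⁻ X, v X ≠ ∞) : ∀ᵐ X, orbitIntegral v X ≠ ∞ := by
  obtain ⟨r, hr, hr0, h⟩ := exists_orbit_weight hv₀ hpos hfin hJ
  -- With h = 1 the finite integral of `v` equals that of `r * orbitIntegral v`, and `r` is almost
  -- nowhere zero.
  have h1 := h (fun _ => 1) v measurable_const (fun _ _ _ _ => rfl) hv
  simp only [one_mul] at h1
  rw [h1] at hvfin
  filter_upwards [ae_lt_top (hr.mul (measurable_orbitIntegral hv)) hvfin, hr0] with X h2 h3 h4
  rw [Pi.mul_apply, h4, ENNReal.mul_top h3] at h2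
  exact lt_irrefl _ h2

/-- The ratio of orbit averages is the likelihood ratio of the invariant functions. -/
theorem lintegral_invariant_mul {v₀ v h : (Fin n → Fin p → ℝ) → ℝ≥0∞} (hv₀ : Measurable v₀)
    (hpos : ∀ X, v₀ X ≠ 0) (hfin : ∫⁻ X, v₀ X ≠ ∞)
    (hJ : ∀ᵐ X, orbitIntegral v₀ X ≠ 0 ∧ orbitIntegral v₀ X ≠ ∞)
    (hv : Measurable v) (hh : Measurable h) (hinv : IsAffineInvariant h) :
    ∫⁻ X, h X * v X = ∫⁻ X, h X * (orbitIntegral v X / orbitIntegral v₀ X) * v₀ X := by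
  obtain ⟨r, hr, hr0, hw⟩ := exists_orbit_weight hv₀ hpos hfin hJ
  have hratio : IsAffineInvariant fun X => orbitIntegral v X / orbitIntegral v₀ X := by
    intro a B hB X
    simp only [orbitIntegral_affineAct hv a hB, orbitIntegral_affineAct hv₀ a hB]
    exact ENNReal.mul_div_mul_left _ _ (detWeight_ne_zero _ hB) (detWeight_ne_top _ _)
  have hratiom := (measurable_orbitIntegral hv).div (measurable_orbitIntegral hv₀)
  -- The ratio is itself invariant, so the weight identity applies to both sides, and both become
  -- the integral of `h * r * orbitIntegral v`.
  rw [hw h v hh hinv hv, hw (fun X => h X * (orbitIntegral v X / orbitIntegral v₀ X)) v₀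
    (hh.mul hratiom) (fun a B hB X => by simp only [hinv a B hB X, hratio a B hB X]) hv₀]
  refine lintegral_congr_ae (hJ.mono fun X hX => ?_)
  simp only
  rw [mul_right_comm (h X) _ (r X), mul_assoc (h X * r X), ENNReal.div_mul_cancel hX.1 hX.2]

/-- The joint density of an i.i.d. sample. -/
noncomputable def sampleDensity (n : ℕ) {p : ℕ} (g : (Fin p → ℝ) → ℝ)
    (X : Fin n → Fin p → ℝ) : ℝ≥0∞ :=
  ENNReal.ofReal (∏ i, g (X i))

theorem measurable_sampleDensity {g : (Fin p → ℝ) → ℝ} (hg : Measurable g) :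
    Measurable (sampleDensity n g) :=
  (Finset.measurable_prod _ fun i _ => hg.comp (measurable_pi_apply i)).ennreal_ofReal

theorem groupIntegral_eq_orbitIntegral {f : ℝ → (Fin p → ℝ) → ℝ} {θ : ℝ}
    (hf : ∀ x, 0 ≤ f θ x) (z : Fin n → Fin p → ℝ) :
    groupIntegral f θ z = orbitIntegral (sampleDensity n (f θ)) z := by
  have h : volume.restrict {B : Fin p → Fin p → ℝ | (Matrix.of B).det ≠ 0} = volume :=
    Measure.restrict_eq_self_of_ae_mem (ae_det_of_ne_zero p)
  rw [groupIntegral, orbitIntegral, h]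
  refine lintegral_congr fun B => lintegral_congr fun a => ?_
  rw [ENNReal.ofReal_mul (Finset.prod_nonneg fun i _ => hf _)]
  rfl

theorem orbitIntegral_ne_zero {v : (Fin n → Fin p → ℝ) → ℝ≥0∞} (hv : Measurable v)
    (hpos : ∀ X, v X ≠ 0) (X : Fin n → Fin p → ℝ) : orbitIntegral v X ≠ 0 := by
  intro h0
  rw [orbitIntegral_eq_prod hv] at h0
  have hm := (measurable_orbit_integrand hv ((n : ℤ) - p - 1)).comp
    (measurable_prodMk_left (x := X))
  have h2 : ∀ᵐ q : (Fin p → Fin p → ℝ) × (Fin p → ℝ), False := by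
    filter_upwards [(lintegral_eq_zero_iff hm).1 h0, ae_det_prod_ne_zero p] with q hq hdet
    have hq' : v (affineAct q.2 (Matrix.of q.1) X) *
        detWeight ((n : ℤ) - p - 1) (Matrix.of q.1) = 0 := hq
    exact mul_ne_zero (hpos _) (detWeight_ne_zero _ hdet) hq'
  exact (@Filter.Eventually.exists _ _ _ (ae_neBot_matrix_prod p) h2).elim fun _ h => h

end

/-! ### The sample covariance matrix and finiteness of the normal orbit average -/

section
variable {n p : ℕ}

theorem sampleMean_affineAct (hn : n ≠ 0) (a : Fin p → ℝ) (B : Matrix (Fin p) (Fin p) ℝ)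
    (X : Fin n → Fin p → ℝ) : sampleMean (affineAct a B X) = a + B *ᵥ sampleMean X := by
  have h : ∑ i, B *ᵥ X i = B *ᵥ ∑ i, X i := (map_sum (Matrix.mulVecLin B) X Finset.univ).symm
  simp only [sampleMean, affineAct, Finset.sum_add_distrib, Finset.sum_const, Finset.card_univ,
    Fintype.card_fin, h, smul_add, Matrix.mulVec_smul]
  rw [← Nat.cast_smul_eq_nsmul ℝ, smul_smul, inv_mul_cancel₀ (Nat.cast_ne_zero.2 hn), one_smul]

theorem sampleCov_affineAct (hn : n ≠ 0) (a : Fin p → ℝ) (B : Matrix (Fin p) (Fin p) ℝ)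
    (X : Fin n → Fin p → ℝ) : sampleCov (affineAct a B X) = B * sampleCov X * Bᵀ := by
  have h : ∀ i, affineAct a B X i - sampleMean (affineAct a B X)
      = B *ᵥ (X i - sampleMean X) := by
    intro i
    rw [sampleMean_affineAct hn, affineAct, Matrix.mulVec_sub]
    abel
  simp only [sampleCov, h, Matrix.mul_smul, Matrix.smul_mul, Finset.mul_sum, Finset.sum_mul,
    Matrix.mul_vecMulVec, Matrix.vecMulVec_mul, Matrix.vecMul_transpose]

theorem posSemidef_sampleCov (X : Fin n → Fin p → ℝ) : (sampleCov X).PosSemidef := by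
  refine Matrix.PosSemidef.smul (Matrix.posSemidef_sum _ fun i _ => ?_) (by positivity)
  exact Matrix.posSemidef_vecMulVec_self_star (X i - sampleMean X)

theorem posDef_sampleCov_iff {X : Fin n → Fin p → ℝ} :
    (sampleCov X).PosDef ↔ (sampleCov X).det ≠ 0 :=
  (posSemidef_sampleCov X).posDef_iff_det_ne_zero

theorem posDef_sampleCov_affineAct (hn : n ≠ 0) (a : Fin p → ℝ) {B : Matrix (Fin p) (Fin p) ℝ}
    (hB : B.det ≠ 0) (X : Fin n → Fin p → ℝ) :
    (sampleCov (affineAct a B X)).PosDef ↔ (sampleCov X).PosDef := by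
  rw [posDef_sampleCov_iff, posDef_sampleCov_iff, sampleCov_affineAct hn, Matrix.det_mul,
    Matrix.det_mul, Matrix.det_transpose]
  simp [hB]

theorem measurableSet_posDef_sampleCov :
    MeasurableSet {X : Fin n → Fin p → ℝ | (sampleCov X).PosDef} := by
  have h : Continuous fun X : Fin n → Fin p → ℝ => (sampleCov X).det := by
    refine Continuous.matrix_det ?_
    refine continuous_matrix fun j k => ?_
    simp only [sampleCov, sampleMean, Matrix.smul_apply, Matrix.sum_apply, Matrix.vecMulVec_apply,
      Pi.sub_apply, Pi.smul_apply, Finset.sum_apply]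
    fun_prop
  simp only [posDef_sampleCov_iff]
  exact (isOpen_ne_fun h continuous_const).measurableSet

theorem sampleCov_quadForm (X : Fin n → Fin p → ℝ) (v : Fin p → ℝ) :
    v ⬝ᵥ (sampleCov X *ᵥ v) = (n : ℝ)⁻¹ * ∑ i, (v ⬝ᵥ (X i - sampleMean X)) ^ 2 := by
  simp only [sampleCov, Matrix.smul_mulVec, Matrix.sum_mulVec, dotProduct_smul, dotProduct_sum,
    smul_eq_mul, Matrix.vecMulVec_mulVec, sq]
  congr 1
  refine Finset.sum_congr rfl fun i _ => ?_
  simp [dotProduct_comm]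

/-- It suffices that the first p + 1 observations are affinely independent, that is, that the square
matrix `D` of differences from the base observation `i₀` is nonsingular. -/
theorem ae_posDef_sampleCov (hn : p + 1 ≤ n) :
    ∀ᵐ X : Fin n → Fin p → ℝ, (sampleCov X).PosDef := by
  let i₀ : Fin n := Fin.castLE hn 0
  let s : Fin p → Fin n := fun j => Fin.castLE hn j.succ
  let D : (Fin n → Fin p → ℝ) → Matrix (Fin p) (Fin p) ℝ :=
    fun X => Matrix.of fun j k => X (s j) k - X i₀ k
  have hD : Continuous D := continuous_matrix fun j k => by
    simp only [D, Matrix.of_apply]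
    fun_prop
  -- Moving each observation `s k` along the k-th basis vector, with `i₀` fixed, adds a multiple of
  -- the identity to `D`.
  let X₀ : Fin n → Fin p → ℝ := fun i k => if i = s k then 1 else 0
  have hs0 : ∀ k, i₀ ≠ s k := fun k h => by
    have := congrArg Fin.val h
    simp [i₀, s] at this
  have hs : ∀ j k, s j = s k ↔ j = k := fun j k => by
    simp [s, Fin.ext_iff]
  have hae := ae_det_ne_zero_of_shift volume D hD X₀ (by
    intro X t
    ext j k
    simp only [D, X₀, Matrix.of_apply, Matrix.add_apply, Matrix.smul_apply, Pi.add_apply,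
      Pi.smul_apply, Matrix.one_apply, hs, hs0, if_false, smul_eq_mul]
    ring)
  refine hae.mono fun X hX => ?_
  have hn0 : (0 : ℝ) < (n : ℝ)⁻¹ := by
    have : 0 < n := by omega
    positivity
  refine Matrix.PosDef.of_dotProduct_mulVec_pos (posSemidef_sampleCov X).isHermitian
    fun v hv => ?_
  rw [star_trivial, sampleCov_quadForm]
  refine mul_pos hn0 (lt_of_le_of_ne (by positivity) fun h0 => hv ?_)
  -- A vanishing quadratic form makes `v` orthogonal to every deviation from the mean, hence to the
  -- rows of `D X`.
  have h1 : ∀ i, v ⬝ᵥ (X i - sampleMean X) = 0 := fun i => by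
    have := (Finset.sum_eq_zero_iff_of_nonneg fun i _ => sq_nonneg _).1 h0.symm i
      (Finset.mem_univ i)
    exact pow_eq_zero_iff two_ne_zero |>.1 this
  refine Matrix.eq_zero_of_mulVec_eq_zero hX ?_
  funext j
  have h2 : v ⬝ᵥ (X (s j) - X i₀) = 0 := by
    have : X (s j) - X i₀ = (X (s j) - sampleMean X) - (X i₀ - sampleMean X) := by abel
    rw [this, dotProduct_sub, h1, h1, sub_zero]
  rw [dotProduct_comm] at h2
  exact h2

theorem det_choleskyRoot_ne_zero {X : Fin n → Fin p → ℝ} (hX : (sampleCov X).PosDef) :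
    (choleskyRoot (sampleCov X)).det ≠ 0 := by
  intro h
  have h1 := hX.det_pos
  rw [(choleskyRoot_spec hX).2.2, Matrix.det_mul, h, zero_mul] at h1
  exact lt_irrefl _ h1

theorem standardized_eq (X : Fin n → Fin p → ℝ) : standardized X
    = affineInv (sampleMean X) (choleskyRoot (sampleCov X)) X := rfl

theorem sampleMean_standardized (hn : n ≠ 0) (X : Fin n → Fin p → ℝ) :
    sampleMean (standardized X) = 0 := by
  rw [standardized_eq, affineInv_eq_affineAct, sampleMean_affineAct hn, neg_add_cancel]

theorem sampleCov_standardized (hn : n ≠ 0) {X : Fin n → Fin p → ℝ} (hX : (sampleCov X).PosDef) :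
    sampleCov (standardized X) = 1 := by
  have hT := det_choleskyRoot_ne_zero hX
  rw [standardized_eq, affineInv_eq_affineAct, sampleCov_affineAct hn]
  set T := choleskyRoot (sampleCov X) with hTdef
  have h := (choleskyRoot_spec hX).2.2
  rw [← hTdef] at h
  rw [h, ← Matrix.mul_assoc, Matrix.nonsing_inv_mul _ (Ne.isUnit hT), Matrix.one_mul,
    ← Matrix.transpose_mul, Matrix.nonsing_inv_mul _ (Ne.isUnit hT), Matrix.transpose_one]

theorem sum_sq_eq_sampleCov (hn : n ≠ 0) (Y : Fin n → Fin p → ℝ) (j : Fin p) :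
    ∑ i, Y i j ^ 2 = n * (sampleCov Y j j + sampleMean Y j ^ 2) := by
  have hn' : (n : ℝ) ≠ 0 := Nat.cast_ne_zero.2 hn
  have hm : ∑ i, Y i j = n * sampleMean Y j := by
    simp [sampleMean, Finset.sum_apply, hn']
  have hc : n * sampleCov Y j j = ∑ i, (Y i j - sampleMean Y j) ^ 2 := by
    simp [sampleCov, Matrix.sum_apply, Matrix.vecMulVec_apply, hn', sq]
  have hexp : ∀ i, (Y i j - sampleMean Y j) ^ 2
      = Y i j ^ 2 - 2 * sampleMean Y j * Y i j + sampleMean Y j ^ 2 := fun i => by ring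
  rw [mul_add, hc]
  simp only [hexp, Finset.sum_add_distrib, Finset.sum_sub_distrib, ← Finset.mul_sum, hm,
    Finset.sum_const, Finset.card_univ, Fintype.card_fin, nsmul_eq_mul]
  ring

/-- The transformed sample has mean a and covariance BB'. The normal exponent thus separates into
the coordinates of a and the entries of B. -/
theorem sum_sq_affineAct (hn : n ≠ 0) {z : Fin n → Fin p → ℝ} (hmean : sampleMean z = 0)
    (hcov : sampleCov z = 1) (a : Fin p → ℝ) (B : Matrix (Fin p) (Fin p) ℝ) :
    ∑ i, ∑ j, affineAct a B z i j ^ 2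
      = ∑ j, (n : ℝ) * a j ^ 2 + ∑ j, ∑ k, (n : ℝ) * B j k ^ 2 := by
  rw [Finset.sum_comm, ← Finset.sum_add_distrib]
  refine Finset.sum_congr rfl fun j _ => ?_
  rw [sum_sq_eq_sampleCov hn, sampleMean_affineAct hn, sampleCov_affineAct hn, hmean, hcov,
    Matrix.mul_one, Matrix.mul_apply]
  simp [← Finset.mul_sum, sq]
  ring

/-- A crude bound whose merit is that it factors over the entries. One factorial counts
permutations, the other comes from x^p ≤ p! exp x. -/
theorem abs_det_le_exp (B : Matrix (Fin p) (Fin p) ℝ) :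
    |B.det| ≤ (p.factorial : ℝ) ^ 2 * Real.exp (∑ j, ∑ k, |B j k|) := by
  set x := ∑ j, ∑ k, |B j k| with hx
  have hx0 : 0 ≤ x := by positivity
  have hle : ∀ j k, AbsoluteValue.abs (B j k) ≤ x := fun j k =>
    (Finset.single_le_sum (f := fun k => |B j k|) (fun _ _ => abs_nonneg _)
      (Finset.mem_univ k)).trans
      (Finset.single_le_sum (f := fun j => ∑ k, |B j k|)
        (fun _ _ => Finset.sum_nonneg fun _ _ => abs_nonneg _) (Finset.mem_univ j))
  have h1 := Matrix.det_le hle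
  have h2 := Real.pow_div_factorial_le_exp x hx0 p
  rw [div_le_iff₀ (by positivity)] at h2
  rw [Fintype.card_fin, nsmul_eq_mul] at h1
  calc |B.det| ≤ p.factorial * x ^ p := h1
    _ ≤ p.factorial * (Real.exp x * p.factorial) := by gcongr
    _ = _ := by ring

theorem integrable_exp_abs_sub_sq (m : ℝ) {b : ℝ} (hb : 0 < b) :
    Integrable fun x : ℝ => Real.exp (m * |x| - b * x ^ 2) := by
  refine ((integrable_exp_neg_mul_sq (half_pos hb)).const_mul
    (Real.exp (m ^ 2 / (2 * b)))).mono' (by fun_prop) (Filter.Eventually.of_forall fun x => ?_)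
  rw [Real.norm_eq_abs, Real.abs_exp, ← Real.exp_add, Real.exp_le_exp]
  -- Completing the square at |x| = m / b, with half of the Gaussian decay kept for integrability.
  have h : m ^ 2 / (2 * b) + -(b / 2) * x ^ 2 - (m * |x| - b * x ^ 2)
      = (b / 2) * (|x| - m / b) ^ 2 := by
    have : x ^ 2 = |x| ^ 2 := (sq_abs x).symm
    rw [this]
    field_simp
    ring
  have : 0 ≤ (b / 2) * (|x| - m / b) ^ 2 := by positivity
  linarith

theorem prod_stdNormalDensity (Y : Fin n → Fin p → ℝ) :
    ∏ i, stdNormalDensity p (Y i) = (((2 * Real.pi) ^ ((p : ℝ) / 2))⁻¹) ^ n *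
      Real.exp (-(∑ i, ∑ j, Y i j ^ 2) / 2) := by
  simp only [stdNormalDensity, Finset.prod_mul_distrib, Finset.prod_const, Finset.card_univ,
    Fintype.card_fin, ← Real.exp_sum]
  rw [← Finset.sum_div, Finset.sum_neg_distrib]

theorem orbitIntegral_stdNormal_ne_top (hn : p + 1 ≤ n) {z : Fin n → Fin p → ℝ}
    (hmean : sampleMean z = 0) (hcov : sampleCov z = 1) :
    orbitIntegral (sampleDensity n (stdNormalDensity p)) z ≠ ∞ := by
  have hn0 : n ≠ 0 := by omega
  have hnpos : (0 : ℝ) < n := by positivity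
  -- The exponent is nonnegative because n ≥ p + 1, so an upper bound on |det B| suffices.
  obtain ⟨m, hm⟩ : ∃ m : ℕ, (n : ℤ) - p - 1 = m := ⟨n - p - 1, by omega⟩
  set c : ℝ := (((2 * Real.pi) ^ ((p : ℝ) / 2))⁻¹) ^ n * ((p.factorial : ℝ) ^ 2) ^ m with hc
  have hc0 : 0 ≤ c := by positivity
  set G : (Fin p → Fin p → ℝ) → ℝ := fun B =>
    ∏ j, ∏ k, Real.exp (m * |B j k| - n / 2 * B j k ^ 2) with hG
  -- The zero term gives the factors of `H` the same shape as those of `G`, for the same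
  -- integrability lemma.
  set H : (Fin p → ℝ) → ℝ := fun a => ∏ j, Real.exp (0 * |a j| - n / 2 * a j ^ 2) with hH
  have hGi : Integrable G := Integrable.fintype_prod (f := fun _ (b : Fin p → ℝ) =>
    ∏ k, Real.exp (m * |b k| - n / 2 * b k ^ 2)) fun _ =>
    Integrable.fintype_prod (f := fun _ x => Real.exp (m * |x| - n / 2 * x ^ 2))
      fun _ => integrable_exp_abs_sub_sq _ (by positivity)
  have hHi : Integrable H :=
    Integrable.fintype_prod (f := fun _ x => Real.exp (0 * |x| - n / 2 * x ^ 2))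
      fun _ => integrable_exp_abs_sub_sq _ (by positivity)
  have hG0 : ∀ B, 0 ≤ G B := fun B => by positivity
  have hH0 : ∀ a, 0 ≤ H a := fun a => by positivity
  have hbound : ∀ (B : Fin p → Fin p → ℝ) (a : Fin p → ℝ),
      sampleDensity n (stdNormalDensity p) (affineAct a (Matrix.of B) z) *
        detWeight ((n : ℤ) - p - 1) (Matrix.of B)
      ≤ ENNReal.ofReal (c * G B) * ENNReal.ofReal (H a) := by
    intro B a
    have hdet : |(Matrix.of B).det| ^ m
        ≤ ((p.factorial : ℝ) ^ 2) ^ m * Real.exp (m * ∑ j, ∑ k, |B j k|) := by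
      rw [Real.exp_nat_mul, ← mul_pow]
      exact pow_le_pow_left₀ (abs_nonneg _) (abs_det_le_exp (Matrix.of B)) m
    have hGH : Real.exp (-(∑ i, ∑ j, affineAct a (Matrix.of B) z i j ^ 2) / 2) *
        Real.exp (m * ∑ j, ∑ k, |B j k|) = G B * H a := by
      simp only [hG, hH, ← Real.exp_sum, ← Real.exp_add]
      congr 1
      rw [sum_sq_affineAct hn0 hmean hcov]
      simp only [Matrix.of_apply, Finset.sum_sub_distrib, ← Finset.mul_sum]
      ring
    rw [sampleDensity, detWeight, hm, zpow_natCast, prod_stdNormalDensity,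
      ← ENNReal.ofReal_mul (by positivity), ← ENNReal.ofReal_mul (by positivity)]
    refine ENNReal.ofReal_le_ofReal ?_
    calc _ ≤ (((2 * Real.pi) ^ ((p : ℝ) / 2))⁻¹) ^ n *
          Real.exp (-(∑ i, ∑ j, affineAct a (Matrix.of B) z i j ^ 2) / 2) *
          (((p.factorial : ℝ) ^ 2) ^ m * Real.exp (m * ∑ j, ∑ k, |B j k|)) := by gcongr
      _ = c * (Real.exp (-(∑ i, ∑ j, affineAct a (Matrix.of B) z i j ^ 2) / 2) *
        Real.exp (m * ∑ j, ∑ k, |B j k|)) := by rw [hc]; ring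
      _ = c * G B * H a := by rw [hGH]; ring
  refine ne_top_of_le_ne_top ?_ (lintegral_mono fun B => lintegral_mono fun a => hbound B a)
  simp only [lintegral_const_mul' _ _ ENNReal.ofReal_ne_top]
  rw [lintegral_mul_const' _ _ hHi.lintegral_lt_top.ne]
  exact ENNReal.mul_ne_top (hGi.const_mul c).lintegral_lt_top.ne hHi.lintegral_lt_top.ne

theorem orbitIntegral_standardized {v : (Fin n → Fin p → ℝ) → ℝ≥0∞} (hv : Measurable v)
    {X : Fin n → Fin p → ℝ} (hX : (sampleCov X).PosDef) :
    orbitIntegral v (standardized X)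
      = detWeight (1 - n) (choleskyRoot (sampleCov X))⁻¹ * orbitIntegral v X := by
  rw [standardized_eq, affineInv_eq_affineAct,
    orbitIntegral_affineAct hv _ (det_inv_ne_zero (det_choleskyRoot_ne_zero hX))]

end

/-! ### Densities and laws of samples -/

/-- A nonnegative measurable function with integral `1`. -/
structure IsProbDensity {p : ℕ} (g : (Fin p → ℝ) → ℝ) : Prop where
  measurable : Measurable g
  nonneg : ∀ x, 0 ≤ g x
  lintegral_eq_one : ∫⁻ x, ENNReal.ofReal (g x) = 1

section
variable {n p : ℕ}

theorem IsProbDensity.integrable {g : (Fin p → ℝ) → ℝ} (hg : IsProbDensity g) : Integrable g := by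
  refine ⟨hg.measurable.aestronglyMeasurable, ?_⟩
  rw [hasFiniteIntegral_iff_ofReal (Filter.Eventually.of_forall hg.nonneg), hg.lintegral_eq_one]
  exact ENNReal.one_lt_top

theorem IsProbDensity.isProbabilityMeasure {g : (Fin p → ℝ) → ℝ} (hg : IsProbDensity g) :
    IsProbabilityMeasure ((volume : Measure (Fin p → ℝ)).withDensity
      fun x => ENNReal.ofReal (g x)) :=
  ⟨by rw [withDensity_apply _ MeasurableSet.univ, Measure.restrict_univ, hg.lintegral_eq_one]⟩

/-- It is enough to compare on boxes, where the truncated joint density is a product of functions of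
one observation each. -/
theorem pi_withDensity_eq {g : (Fin p → ℝ) → ℝ} (hg : IsProbDensity g) :
    (Measure.pi fun _ : Fin n => (volume : Measure (Fin p → ℝ)).withDensity
      fun x => ENNReal.ofReal (g x)) = volume.withDensity (sampleDensity n g) := by
  have := hg.isProbabilityMeasure
  refine Measure.pi_eq fun s hs => ?_
  have hI : ∀ i, Integrable ((s i).indicator g) := fun i => hg.integrable.indicator (hs i)
  have hI0 : ∀ i x, 0 ≤ (s i).indicator g x := fun i x =>
    Set.indicator_nonneg (fun y _ => hg.nonneg y) x
  have hprod : ∀ X : Fin n → Fin p → ℝ, (Set.univ.pi s).indicator (sampleDensity n g) X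
      = ENNReal.ofReal (∏ i, (s i).indicator g (X i)) := by
    intro X
    by_cases hX : X ∈ Set.univ.pi s
    · rw [Set.indicator_of_mem hX, sampleDensity]
      congr 1
      exact Finset.prod_congr rfl fun i _ => (Set.indicator_of_mem (hX i (Set.mem_univ i)) g).symm
    · rw [Set.indicator_of_notMem hX]
      obtain ⟨i, hi⟩ : ∃ i, X i ∉ s i := by simpa [Set.mem_pi] using hX
      rw [Finset.prod_eq_zero (Finset.mem_univ i) (Set.indicator_of_notMem hi g),
        ENNReal.ofReal_zero]
  have hprodI : Integrable fun X : Fin n → Fin p → ℝ => ∏ i, (s i).indicator g (X i) :=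
    Integrable.fintype_prod_dep hI
  rw [withDensity_apply _ (MeasurableSet.univ_pi hs),
    ← lintegral_indicator (MeasurableSet.univ_pi hs), lintegral_congr hprod,
    ← ofReal_integral_eq_lintegral_ofReal hprodI
      (Filter.Eventually.of_forall fun X => Finset.prod_nonneg fun i _ => hI0 i _),
    integral_fintype_prod_volume_eq_prod,
    ENNReal.ofReal_prod_of_nonneg fun i _ => integral_nonneg (hI0 i)]
  refine Finset.prod_congr rfl fun i _ => ?_
  rw [ofReal_integral_eq_lintegral_ofReal (hI i) (Filter.Eventually.of_forall (hI0 i)),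
    withDensity_apply _ (hs i), ← lintegral_indicator (hs i)]
  refine lintegral_congr fun x => ?_
  by_cases hx : x ∈ s i <;> simp [hx]

theorem sampleLaw_zero_one {f : ℝ → (Fin p → ℝ) → ℝ} {θ : ℝ} (hf : IsProbDensity (f θ)) :
    sampleLaw n f θ 0 1 = volume.withDensity (sampleDensity n (f θ)) := by
  rw [← pi_withDensity_eq hf, sampleLaw]
  simp [affineDensity]

theorem isProbabilityMeasure_sampleLaw {f : ℝ → (Fin p → ℝ) → ℝ} {θ : ℝ}
    (hf : IsProbDensity (f θ)) : IsProbabilityMeasure (sampleLaw n f θ 0 1) := by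
  have := hf.isProbabilityMeasure
  rw [sampleLaw_zero_one hf, ← pi_withDensity_eq hf]
  infer_instance

theorem withDensity_affineDensity {f : ℝ → (Fin p → ℝ) → ℝ} {θ : ℝ} (hf : IsProbDensity (f θ))
    (a : Fin p → ℝ) {B : Matrix (Fin p) (Fin p) ℝ} (hB : B.det ≠ 0) :
    (volume : Measure (Fin p → ℝ)).withDensity (fun x => ENNReal.ofReal (affineDensity f θ a B x))
      = (volume.withDensity fun x => ENNReal.ofReal (f θ x)).map fun x => a + B *ᵥ x := by
  have hlin : ∀ C : Matrix (Fin p) (Fin p) ℝ, Measurable fun x : Fin p → ℝ => C *ᵥ x := fun C =>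
    (Matrix.toLin' C).continuous_of_finiteDimensional.measurable
  have hact : Measurable fun x : Fin p → ℝ => a + B *ᵥ x := (hlin B).const_add a
  ext s hs
  rw [Measure.map_apply hact hs, withDensity_apply _ hs, withDensity_apply _ (hact hs),
    ← lintegral_indicator hs, ← lintegral_indicator (hact hs)]
  set G : (Fin p → ℝ) → ℝ≥0∞ := s.indicator fun x => ENNReal.ofReal (f θ (B⁻¹ *ᵥ (x - a))) with hG
  have hGm : Measurable G :=
    (hf.measurable.comp ((hlin B⁻¹).comp (measurable_id.sub_const a))).ennreal_ofReal.indicator hs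
  have h := lintegral_mulVec hB (F := fun x => G (a + x)) (hGm.comp (measurable_const_add a))
  rw [lintegral_add_left_eq_self G a] at h
  have h1 : ∀ x, s.indicator (fun x => ENNReal.ofReal (affineDensity f θ a B x)) x
      = detWeight (-1) B * G x := by
    intro x
    by_cases hx : x ∈ s
    · simp [hx, hG, affineDensity, detWeight, ENNReal.ofReal_mul]
    · simp [hx, hG]
  rw [lintegral_congr h1, lintegral_const_mul' _ _ (detWeight_ne_top _ _), ← h]
  refine lintegral_congr fun x => ?_
  by_cases hx : a + B *ᵥ x ∈ s
  · have hx' : x ∈ (fun x => a + B *ᵥ x) ⁻¹' s := hx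
    rw [Set.indicator_of_mem hx', hG]
    simp [hx, Matrix.mulVec_mulVec, Matrix.nonsing_inv_mul _ (Ne.isUnit hB)]
  · have hx' : x ∉ (fun x => a + B *ᵥ x) ⁻¹' s := hx
    rw [Set.indicator_of_notMem hx', hG, Set.indicator_of_notMem hx]

theorem sampleLaw_eq_map {f : ℝ → (Fin p → ℝ) → ℝ} {θ : ℝ} (hf : IsProbDensity (f θ))
    (a : Fin p → ℝ) {B : Matrix (Fin p) (Fin p) ℝ} (hB : B.det ≠ 0) :
    sampleLaw n f θ a B = (sampleLaw n f θ 0 1).map (affineAct a B) := by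
  have := hf.isProbabilityMeasure
  have hact : Measurable fun x : Fin p → ℝ => a + B *ᵥ x :=
    ((Matrix.toLin' B).continuous_of_finiteDimensional.measurable).const_add a
  have hp : IsProbabilityMeasure ((volume.withDensity fun x => ENNReal.ofReal (f θ x)).map
    fun x => a + B *ᵥ x) := Measure.isProbabilityMeasure_map hact.aemeasurable
  rw [sampleLaw_zero_one hf, ← pi_withDensity_eq hf, sampleLaw,
    withDensity_affineDensity hf a hB]
  exact (Measure.pi_map_pi fun _ => hact.aemeasurable).symm

/-- The law at (a, B) is the image of the law at (0, I) under the action, which the test does not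
see. This eliminates the nuisance parameter. -/
theorem IsInvariantTest.integral_sampleLaw {φ : (Fin n → Fin p → ℝ) → ℝ} (hφ : IsInvariantTest φ)
    {f : ℝ → (Fin p → ℝ) → ℝ} {θ : ℝ} (hf : IsProbDensity (f θ))
    (a : Fin p → ℝ) {B : Matrix (Fin p) (Fin p) ℝ} (hB : B.det ≠ 0) :
    ∫ X, φ X ∂(sampleLaw n f θ a B) = ∫ X, φ X ∂(sampleLaw n f θ 0 1) := by
  rw [sampleLaw_eq_map hf a hB, integral_map (measurable_affineAct a B).aemeasurable
    hφ.measurable.aestronglyMeasurable]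
  exact integral_congr_ae (Filter.Eventually.of_forall fun X => hφ.invariant a B hB X)

end

/-! ### The Neyman–Pearson lemma and the choice of threshold -/

theorem integrable_mul_of_mem_unitInterval {Ω : Type*} [MeasurableSpace Ω]
    {P : Measure Ω} {φ Λ : Ω → ℝ} (hΛ : Integrable Λ P)
    (hφ : Measurable φ) (h0 : ∀ x, 0 ≤ φ x) (h1 : ∀ x, φ x ≤ 1) :
    Integrable (fun x => φ x * Λ x) P :=
  hΛ.bdd_mul hφ.aestronglyMeasurable
    (Filter.Eventually.of_forall fun x => by rw [Real.norm_of_nonneg (h0 x)]; exact h1 x)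

section NeymanPearson
variable {Ω : Type*} [MeasurableSpace Ω] {P : Measure Ω} [IsProbabilityMeasure P]

theorem integrable_of_mem_unitInterval {φ : Ω → ℝ} (hφ : Measurable φ) (h0 : ∀ x, 0 ≤ φ x)
    (h1 : ∀ x, φ x ≤ 1) : Integrable φ P :=
  Integrable.of_bound hφ.aestronglyMeasurable 1
    (Filter.Eventually.of_forall fun x => by rw [Real.norm_of_nonneg (h0 x)]; exact h1 x)

/-- The Neyman–Pearson lemma, with its uniqueness part. -/
theorem neymanPearson {Λ φ ψ : Ω → ℝ} (hΛ : Integrable Λ P) {k : ℝ} (hk : 0 ≤ k)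
    (hφ : Measurable φ) (hφ0 : ∀ x, 0 ≤ φ x) (hφ1 : ∀ x, φ x ≤ 1)
    (hψ : Measurable ψ) (hψ0 : ∀ x, 0 ≤ ψ x) (hψ1 : ∀ x, ψ x ≤ 1)
    (hgt : ∀ᵐ x ∂P, k < Λ x → φ x = 1) (hlt : ∀ᵐ x ∂P, Λ x < k → φ x = 0)
    (hsize : ∫ x, ψ x ∂P ≤ ∫ x, φ x ∂P) :
    ∫ x, ψ x * Λ x ∂P ≤ ∫ x, φ x * Λ x ∂P ∧
      (∫ x, φ x * Λ x ∂P ≤ ∫ x, ψ x * Λ x ∂P →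
        (∀ᵐ x ∂P, Λ x ≠ k → ψ x = φ x) ∧ (0 < k → ∫ x, ψ x ∂P = ∫ x, φ x ∂P)) := by
  have iφ := integrable_of_mem_unitInterval (P := P) hφ hφ0 hφ1
  have iψ := integrable_of_mem_unitInterval (P := P) hψ hψ0 hψ1
  have iφΛ := integrable_mul_of_mem_unitInterval hΛ hφ hφ0 hφ1
  have iψΛ := integrable_mul_of_mem_unitInterval hΛ hψ hψ0 hψ1
  -- Where Λ exceeds k, φ takes its largest possible value; where Λ is below k, its smallest.
  have hnn : 0 ≤ᵐ[P] fun x => (φ x - ψ x) * (Λ x - k) := by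
    filter_upwards [hgt, hlt] with x h1 h2
    rcases lt_trichotomy (Λ x) k with h | h | h
    · rw [h2 h, Pi.zero_apply]
      exact mul_nonneg_of_nonpos_of_nonpos (by linarith [hψ0 x]) (by linarith)
    · simp [h]
    · rw [h1 h, Pi.zero_apply]
      exact mul_nonneg (by linarith [hψ1 x]) (by linarith)
  have hexp : (fun x => (φ x - ψ x) * (Λ x - k))
      = fun x => (φ x * Λ x - ψ x * Λ x) - k * (φ x - ψ x) := by
    funext x; ring
  have hi : Integrable (fun x => (φ x - ψ x) * (Λ x - k)) P := by
    rw [hexp]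
    exact (iφΛ.sub iψΛ).sub ((iφ.sub iψ).const_mul k)
  have hval : ∫ x, (φ x - ψ x) * (Λ x - k) ∂P
      = (∫ x, φ x * Λ x ∂P - ∫ x, ψ x * Λ x ∂P) - k * (∫ x, φ x ∂P - ∫ x, ψ x ∂P) := by
    have hi1 : Integrable (fun x => φ x * Λ x - ψ x * Λ x) P := iφΛ.sub iψΛ
    have hi2 : Integrable (fun x => k * (φ x - ψ x)) P := (iφ.sub iψ).const_mul k
    rw [hexp, integral_sub hi1 hi2, integral_sub iφΛ iψΛ, integral_const_mul, integral_sub iφ iψ]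
  have hge := integral_nonneg_of_ae hnn
  have hk2 : 0 ≤ k * (∫ x, φ x ∂P - ∫ x, ψ x ∂P) := mul_nonneg hk (by linarith)
  rw [hval] at hge
  -- The gain in power is at least k times the slack in size. If there is no gain, the nonnegative
  -- integrand has integral zero and, for k > 0, the slack is zero as well.
  refine ⟨by linarith, fun hle => ⟨?_, fun hkpos => ?_⟩⟩
  · have hzero : ∫ x, (φ x - ψ x) * (Λ x - k) ∂P = 0 := by
      rw [hval]; linarith
    filter_upwards [(integral_eq_zero_iff_of_nonneg_ae hnn hi).1 hzero] with x hx hne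
    have := (mul_eq_zero.1 hx).resolve_right (sub_ne_zero.2 hne)
    linarith
  · have h3 : k * (∫ x, φ x ∂P - ∫ x, ψ x ∂P) = 0 := by linarith
    have := (mul_eq_zero.1 h3).resolve_left hkpos.ne'
    linarith

/-- A nonnegative random variable admits a threshold and a randomization of any given size. -/
theorem exists_threshold {Y : Ω → ℝ} (hY : Measurable Y) (hY0 : ∀ x, 0 ≤ Y x) {α : ℝ}
    (hα0 : 0 < α) (hα1 : α < 1) :
    ∃ k γ : ℝ, 0 ≤ k ∧ ((∀ᵐ x ∂P, 0 < Y x) → 0 < k) ∧ 0 ≤ γ ∧ γ ≤ 1 ∧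
      P.real {x | k < Y x} + γ * P.real {x | Y x = k} = α := by
  have hμ : IsProbabilityMeasure (P.map Y) := Measure.isProbabilityMeasure_map hY.aemeasurable
  set F := ProbabilityTheory.cdf (P.map Y) with hF
  have hFval : ∀ t, F t = P.real {x | Y x ≤ t} := fun t => by
    rw [hF, ProbabilityTheory.cdf_eq_real, Measure.real, Measure.map_apply hY measurableSet_Iic]
    rfl
  have hneg : ∀ t < 0, F t = 0 := fun t ht => by
    rw [hFval]
    have : {x | Y x ≤ t} = ∅ := by
      ext x; simp; linarith [hY0 x]
    simp [this]
  -- The threshold is the lower (1 - α)-quantile. Right continuity of F and its left limit there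
  -- give P(Y > k) ≤ α ≤ P(Y ≥ k).
  set A : Set ℝ := {t | 1 - α ≤ F t} with hA
  have hA0 : ∀ t ∈ A, 0 ≤ t := fun t ht => by
    by_contra h
    have h1 : 1 - α ≤ F t := ht
    rw [hneg t (not_le.1 h)] at h1
    linarith
  have hne : A.Nonempty := by
    have := (ProbabilityTheory.tendsto_cdf_atTop (P.map Y)).eventually
      (lt_mem_nhds (show 1 - α < 1 by linarith))
    obtain ⟨t, ht⟩ := this.exists
    exact ⟨t, le_of_lt ht⟩
  have hbdd : BddBelow A := ⟨0, hA0⟩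
  set k := sInf A with hkdef
  have hk0 : 0 ≤ k := le_csInf hne hA0
  have hup : ∀ t, k < t → 1 - α ≤ F t := fun t ht => by
    obtain ⟨s, hs, hst⟩ := exists_lt_of_csInf_lt hne ht
    exact le_trans hs (ProbabilityTheory.monotone_cdf _ hst.le)
  have hkF : 1 - α ≤ F k := by
    have h1 : Filter.Tendsto F (nhdsWithin k (Set.Ioi k)) (nhds (F k)) :=
      (F.right_continuous k).mono_left (nhdsWithin_mono k Set.Ioi_subset_Ici_self)
    exact ge_of_tendsto h1 (eventually_nhdsWithin_of_forall hup)
  have hlow : P.real {x | Y x < k} ≤ 1 - α := by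
    have h1 : Filter.Tendsto F (nhdsWithin k (Set.Iio k)) (nhds (Function.leftLim F k)) :=
      (ProbabilityTheory.monotone_cdf (P.map Y)).tendsto_leftLim k
    have h2 : Function.leftLim F k ≤ 1 - α :=
      le_of_tendsto h1 (eventually_nhdsWithin_of_forall fun t ht => by
        by_contra h
        exact absurd (csInf_le hbdd (show t ∈ A from (not_le.1 h).le)) (not_le.2 ht))
    have h3 : (P.map Y) (Set.Iio k) = ENNReal.ofReal (Function.leftLim F k - 0) := by
      rw [← ProbabilityTheory.measure_cdf (P.map Y)]
      exact StieltjesFunction.measure_Iio _ (ProbabilityTheory.tendsto_cdf_atBot _) _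
    rw [Measure.map_apply hY measurableSet_Iio, sub_zero] at h3
    have h4 : P.real {x | Y x < k} = (ENNReal.ofReal (Function.leftLim F k)).toReal :=
      congrArg ENNReal.toReal h3
    rw [h4]
    refine (ENNReal.toReal_mono ENNReal.ofReal_ne_top (ENNReal.ofReal_le_ofReal h2)).trans ?_
    rw [ENNReal.toReal_ofReal (by linarith)]
  have hmlt : MeasurableSet {x | Y x < k} := hY measurableSet_Iio
  have hmeq : MeasurableSet {x | Y x = k} := hY (measurableSet_singleton k)
  have hmle : MeasurableSet {x | Y x ≤ k} := hY measurableSet_Iic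
  have hsplit : P.real {x | Y x ≤ k} = P.real {x | Y x < k} + P.real {x | Y x = k} := by
    rw [← measureReal_union _ hmeq]
    · congr 1
      ext x
      simp [le_iff_lt_or_eq]
    · exact Set.disjoint_left.2 fun x h1 h2 => (ne_of_lt h1) h2
  have hcompl : P.real {x | k < Y x} = 1 - P.real {x | Y x ≤ k} := by
    rw [← probReal_compl_eq_one_sub hmle]
    congr 1
    ext x; simp
  have hgt : P.real {x | k < Y x} ≤ α := by
    rw [hcompl, ← hFval]; linarith
  have hpos : (∀ᵐ x ∂P, 0 < Y x) → 0 < k := fun h => by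
    refine lt_of_le_of_ne hk0 fun h0 => ?_
    have h1 : P {x | Y x ≤ k} = 0 := by
      rw [← h0]
      rw [ae_iff] at h
      simpa using h
    rw [hFval, Measure.real, h1] at hkF
    simp at hkF
    linarith
  rcases eq_or_ne (P.real {x | Y x = k}) 0 with h0 | h0
  · exact ⟨k, 0, hk0, hpos, le_rfl, zero_le_one, by linarith⟩
  · have hpeq : 0 < P.real {x | Y x = k} := lt_of_le_of_ne measureReal_nonneg h0.symm
    -- Randomization uses just the fraction of the atom at k needed to fill the size up to α.
    refine ⟨k, (α - P.real {x | k < Y x}) / P.real {x | Y x = k}, hk0, hpos,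
      div_nonneg (by linarith) hpeq.le, (div_le_one hpeq).2 (by linarith), ?_⟩
    rw [div_mul_cancel₀ _ h0]
    ring

end NeymanPearson

/-! ### Ratio tests and their optimality -/

section
variable {n p : ℕ}

theorem stdNormalDensity_pos (p : ℕ) (x : Fin p → ℝ) : 0 < stdNormalDensity p x := by
  unfold stdNormalDensity
  positivity

theorem sampleDensity_ne_zero {g : (Fin p → ℝ) → ℝ} (hg : ∀ x, 0 < g x)
    (X : Fin n → Fin p → ℝ) : sampleDensity n g X ≠ 0 := by
  rw [sampleDensity, Ne, ENNReal.ofReal_eq_zero, not_le]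
  exact Finset.prod_pos fun i _ => hg _

theorem lintegral_sampleDensity {g : (Fin p → ℝ) → ℝ} (hg : IsProbDensity g) :
    ∫⁻ X, sampleDensity n g X = 1 := by
  have := hg.isProbabilityMeasure
  have h := congrArg (fun μ => μ Set.univ) (pi_withDensity_eq (n := n) hg)
  simp only [measure_univ, withDensity_apply _ MeasurableSet.univ, Measure.restrict_univ] at h
  exact h.symm

/-- Finiteness at the standardized sample passes to `X`, which lies on the same orbit. -/
theorem orbitIntegral_stdNormal (hn : p + 1 ≤ n) (hd : IsProbDensity (stdNormalDensity p))
    {X : Fin n → Fin p → ℝ} (hX : (sampleCov X).PosDef) :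
    orbitIntegral (sampleDensity n (stdNormalDensity p)) X ≠ 0 ∧
      orbitIntegral (sampleDensity n (stdNormalDensity p)) X ≠ ∞ := by
  have hm := measurable_sampleDensity (n := n) hd.measurable
  have hn0 : n ≠ 0 := by omega
  refine ⟨orbitIntegral_ne_zero hm (sampleDensity_ne_zero (stdNormalDensity_pos p)) X, fun h => ?_⟩
  have h1 := orbitIntegral_stdNormal_ne_top hn (sampleMean_standardized hn0 X)
    (sampleCov_standardized hn0 hX)
  rw [orbitIntegral_standardized hm hX, h, ENNReal.mul_top
    (detWeight_ne_zero _ (det_inv_ne_zero (det_choleskyRoot_ne_zero hX)))] at h1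
  exact h1 rfl

/-- The likelihood ratio of the maximal invariant. -/
noncomputable def orbitRatio (n : ℕ) {p : ℕ} (f : ℝ → (Fin p → ℝ) → ℝ) (θ : ℝ)
    (X : Fin n → Fin p → ℝ) : ℝ≥0∞ :=
  orbitIntegral (sampleDensity n (f θ)) X / orbitIntegral (sampleDensity n (f 0)) X

variable {f : ℝ → (Fin p → ℝ) → ℝ} {θ : ℝ}

theorem measurable_orbitRatio (h0 : IsProbDensity (f 0)) (h1 : IsProbDensity (f θ)) :
    Measurable (orbitRatio n f θ) :=
  (measurable_orbitIntegral (measurable_sampleDensity h1.measurable)).div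
    (measurable_orbitIntegral (measurable_sampleDensity h0.measurable))

theorem isAffineInvariant_orbitRatio (h0 : IsProbDensity (f 0)) (h1 : IsProbDensity (f θ)) :
    IsAffineInvariant (orbitRatio n f θ) := fun a B hB X => by
  simp only [orbitRatio, orbitIntegral_affineAct (measurable_sampleDensity h1.measurable) a hB,
    orbitIntegral_affineAct (measurable_sampleDensity h0.measurable) a hB]
  exact ENNReal.mul_div_mul_left _ _ (detWeight_ne_zero _ hB) (detWeight_ne_top _ _)

/-- Standardization moves along the orbit, where the ratio is constant. Measurability and invariance
of the regions can therefore be read off a formula free of the Cholesky root. -/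
theorem invariantRatio_eq_orbitRatio (h0 : IsProbDensity (f 0)) (h1 : IsProbDensity (f θ))
    {X : Fin n → Fin p → ℝ} (hX : (sampleCov X).PosDef) :
    invariantRatio f θ X = orbitRatio n f θ X := by
  rw [invariantRatio, groupIntegral_eq_orbitIntegral h1.nonneg,
    groupIntegral_eq_orbitIntegral h0.nonneg,
    ← isAffineInvariant_orbitRatio h0 h1 _ _ (det_inv_ne_zero (det_choleskyRoot_ne_zero hX)) X,
    ← affineInv_eq_affineAct]
  rfl

theorem criticalRegion_eq (h0 : IsProbDensity (f 0)) (h1 : IsProbDensity (f θ)) (k : ℝ) :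
    criticalRegion n f θ k = {X | (sampleCov X).PosDef} ∩
      {X | ENNReal.ofReal k < orbitRatio n f θ X} := by
  ext X
  simp only [criticalRegion, Set.mem_inter_iff, Set.mem_ofPred_eq]
  exact and_congr_right fun hX => by rw [invariantRatio_eq_orbitRatio h0 h1 hX]

theorem boundaryRegion_eq (h0 : IsProbDensity (f 0)) (h1 : IsProbDensity (f θ)) (k : ℝ) :
    boundaryRegion n f θ k = {X | (sampleCov X).PosDef} ∩
      {X | orbitRatio n f θ X = ENNReal.ofReal k} := by
  ext X
  simp only [boundaryRegion, Set.mem_inter_iff, Set.mem_ofPred_eq]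
  exact and_congr_right fun hX => by rw [invariantRatio_eq_orbitRatio h0 h1 hX]

theorem measurableSet_criticalRegion (h0 : IsProbDensity (f 0)) (h1 : IsProbDensity (f θ))
    (k : ℝ) : MeasurableSet (criticalRegion n f θ k) := by
  rw [criticalRegion_eq h0 h1]
  exact measurableSet_posDef_sampleCov.inter (measurable_orbitRatio h0 h1 measurableSet_Ioi)

theorem measurableSet_boundaryRegion (h0 : IsProbDensity (f 0)) (h1 : IsProbDensity (f θ))
    (k : ℝ) : MeasurableSet (boundaryRegion n f θ k) := by
  rw [boundaryRegion_eq h0 h1]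
  exact measurableSet_posDef_sampleCov.inter
    (measurable_orbitRatio h0 h1 (measurableSet_singleton _))

theorem disjoint_criticalRegion_boundaryRegion (k : ℝ) :
    Disjoint (criticalRegion n f θ k) (boundaryRegion n f θ k) :=
  Set.disjoint_left.2 fun _ h1 h2 => (ne_of_gt h1.2) h2.2

/-- The test rejecting when the ratio exceeds `k`, and with probability `γ` when it equals `k`. -/
noncomputable def ratioTest (n : ℕ) {p : ℕ} (f : ℝ → (Fin p → ℝ) → ℝ) (θ k γ : ℝ)
    (X : Fin n → Fin p → ℝ) : ℝ :=
  (criticalRegion n f θ k).indicator 1 X + γ * (boundaryRegion n f θ k).indicator 1 X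

theorem ratioTest_of_mem_criticalRegion {k γ : ℝ} {X : Fin n → Fin p → ℝ}
    (hX : X ∈ criticalRegion n f θ k) : ratioTest n f θ k γ X = 1 := by
  have := Set.disjoint_left.1 (disjoint_criticalRegion_boundaryRegion k) hX
  simp [ratioTest, hX, this]

theorem ratioTest_of_notMem_boundaryRegion {k γ : ℝ} {X : Fin n → Fin p → ℝ}
    (hX : X ∉ boundaryRegion n f θ k) :
    ratioTest n f θ k γ X = (criticalRegion n f θ k).indicator 1 X := by
  simp [ratioTest, hX]

theorem ratioTest_of_mem_boundaryRegion {k γ : ℝ} {X : Fin n → Fin p → ℝ}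
    (hX : X ∈ boundaryRegion n f θ k) : ratioTest n f θ k γ X = γ := by
  have := Set.disjoint_right.1 (disjoint_criticalRegion_boundaryRegion k) hX
  simp [ratioTest, hX, this]

theorem isInvariantTest_ratioTest (hn : p + 1 ≤ n) (h0 : IsProbDensity (f 0))
    (h1 : IsProbDensity (f θ)) (k : ℝ) {γ : ℝ} (hγ0 : 0 ≤ γ) (hγ1 : γ ≤ 1) :
    IsInvariantTest (ratioTest n f θ k γ) where
  measurable := (measurable_one.indicator (measurableSet_criticalRegion h0 h1 k)).add
    ((measurable_one.indicator (measurableSet_boundaryRegion h0 h1 k)).const_mul γ)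
  nonneg X := add_nonneg (Set.indicator_nonneg (fun _ _ => zero_le_one) X)
    (mul_nonneg hγ0 (Set.indicator_nonneg (fun _ _ => zero_le_one) X))
  le_one X := by
    by_cases hX : X ∈ boundaryRegion n f θ k
    · rwa [ratioTest_of_mem_boundaryRegion hX]
    · rw [ratioTest_of_notMem_boundaryRegion hX]
      exact Set.indicator_le_self' (fun _ _ => zero_le_one) X
  invariant a B hB X := by
    have hc : affineAct a B X ∈ criticalRegion n f θ k ↔ X ∈ criticalRegion n f θ k := by
      rw [criticalRegion_eq h0 h1]
      simp only [Set.mem_inter_iff, Set.mem_ofPred_eq, isAffineInvariant_orbitRatio h0 h1 a B hB X,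
        posDef_sampleCov_affineAct (by omega) a hB X]
    have hb : affineAct a B X ∈ boundaryRegion n f θ k ↔ X ∈ boundaryRegion n f θ k := by
      rw [boundaryRegion_eq h0 h1]
      simp only [Set.mem_inter_iff, Set.mem_ofPred_eq, isAffineInvariant_orbitRatio h0 h1 a B hB X,
        posDef_sampleCov_affineAct (by omega) a hB X]
    classical
    simp only [ratioTest, Set.indicator_apply, hc, hb]
    rfl

variable (hn : p + 1 ≤ n) (hzero : f 0 = stdNormalDensity p) (h0 : IsProbDensity (f 0))
  (h1 : IsProbDensity (f θ))
include hn hzero h0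

theorem ae_orbitIntegral_zero :
    ∀ᵐ X, orbitIntegral (sampleDensity n (f 0)) X ≠ 0 ∧
      orbitIntegral (sampleDensity n (f 0)) X ≠ ∞ := by
  rw [hzero] at h0 ⊢
  exact (ae_posDef_sampleCov hn).mono fun X hX => orbitIntegral_stdNormal hn h0 hX

include h1

theorem ae_orbitIntegral_ne_top : ∀ᵐ X, orbitIntegral (sampleDensity n (f θ)) X ≠ ∞ := by
  have hfin : ∀ {g : (Fin p → ℝ) → ℝ}, IsProbDensity g → ∫⁻ X, sampleDensity n g X ≠ ∞ := by
    intro g hg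
    rw [lintegral_sampleDensity hg]
    exact ENNReal.one_ne_top
  refine orbitIntegral_ae_ne_top (measurable_sampleDensity h0.measurable) ?_ (hfin h0)
    (ae_orbitIntegral_zero hn hzero h0) (measurable_sampleDensity h1.measurable) (hfin h1)
  rw [hzero]
  exact sampleDensity_ne_zero (stdNormalDensity_pos p)

theorem ae_orbitRatio_ne_top : ∀ᵐ X, orbitRatio n f θ X ≠ ∞ := by
  filter_upwards [ae_orbitIntegral_ne_top hn hzero h0 h1, ae_orbitIntegral_zero hn hzero h0]
    with X hX hX0
  exact ENNReal.div_ne_top hX hX0.1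

theorem lintegral_sampleLaw_eq {h : (Fin n → Fin p → ℝ) → ℝ≥0∞} (hh : Measurable h)
    (hinv : IsAffineInvariant h) :
    ∫⁻ X, h X ∂(sampleLaw n f θ 0 1) = ∫⁻ X, h X * orbitRatio n f θ X ∂(sampleLaw n f 0 0 1) := by
  have hv₀ := measurable_sampleDensity (n := n) h0.measurable
  have hv := measurable_sampleDensity (n := n) h1.measurable
  have hpos : ∀ X, sampleDensity n (f 0) X ≠ 0 := by
    rw [hzero]
    exact sampleDensity_ne_zero (stdNormalDensity_pos p)
  have hfin : ∫⁻ X, sampleDensity n (f 0) X ≠ ∞ := by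
    rw [lintegral_sampleDensity h0]
    exact ENNReal.one_ne_top
  rw [sampleLaw_zero_one h0, sampleLaw_zero_one h1, lintegral_withDensity_eq_lintegral_mul _ hv hh,
    lintegral_withDensity_eq_lintegral_mul _ hv₀
      (g := fun X => h X * orbitRatio n f θ X) (hh.mul (measurable_orbitRatio h0 h1))]
  simp only [Pi.mul_apply, mul_comm (sampleDensity n _ _)]
  exact lintegral_invariant_mul hv₀ hpos hfin (ae_orbitIntegral_zero hn hzero h0) hv hh hinv

omit hn h1 in
theorem volume_absolutelyContinuous_sampleLaw :
    (volume : Measure (Fin n → Fin p → ℝ)) ≪ sampleLaw n f 0 0 1 := by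
  rw [sampleLaw_zero_one h0]
  refine withDensity_absolutelyContinuous'
    (measurable_sampleDensity h0.measurable).aemeasurable (Filter.Eventually.of_forall ?_)
  rw [hzero]
  exact sampleDensity_ne_zero (stdNormalDensity_pos p)

omit hn hzero h1 in
theorem sampleLaw_absolutelyContinuous :
    sampleLaw n f 0 0 1 ≪ (volume : Measure (Fin n → Fin p → ℝ)) := by
  rw [sampleLaw_zero_one h0]
  exact withDensity_absolutelyContinuous _ _

theorem integrable_orbitRatio :
    Integrable (fun X => (orbitRatio n f θ X).toReal) (sampleLaw n f 0 0 1) := by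
  refine integrable_toReal_of_lintegral_ne_top (measurable_orbitRatio h0 h1).aemeasurable ?_
  have h := lintegral_sampleLaw_eq hn hzero h0 h1 (h := fun _ => 1) measurable_const
    (fun _ _ _ _ => rfl)
  have := isProbabilityMeasure_sampleLaw (n := n) h1
  simp only [one_mul, lintegral_one, measure_univ] at h
  rw [← h]
  exact ENNReal.one_ne_top

theorem IsInvariantTest.integral_eq {φ : (Fin n → Fin p → ℝ) → ℝ} (hφ : IsInvariantTest φ) :
    ∫ X, φ X ∂(sampleLaw n f θ 0 1)
      = ∫ X, φ X * (orbitRatio n f θ X).toReal ∂(sampleLaw n f 0 0 1) := by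
  rw [integral_eq_lintegral_of_nonneg_ae (Filter.Eventually.of_forall hφ.nonneg)
      hφ.measurable.aestronglyMeasurable,
    integral_eq_lintegral_of_nonneg_ae (Filter.Eventually.of_forall fun X =>
      mul_nonneg (hφ.nonneg X) ENNReal.toReal_nonneg)
      (hφ.measurable.mul (measurable_orbitRatio h0 h1).ennreal_toReal).aestronglyMeasurable,
    lintegral_sampleLaw_eq hn hzero h0 h1 hφ.measurable.ennreal_ofReal
      (fun a B hB X => by simp only [hφ.invariant a B hB X])]
  congr 1
  refine lintegral_congr_ae ?_
  filter_upwards [(sampleLaw_absolutelyContinuous h0).ae_le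
    (ae_orbitRatio_ne_top hn hzero h0 h1)] with X hX
  rw [ENNReal.ofReal_mul (hφ.nonneg X), ENNReal.ofReal_toReal hX]

/-- Passes from the extended ratio to the real one required by the Neyman–Pearson lemma. -/
theorem ae_mem_regions {k : ℝ} (hk : 0 ≤ k) : ∀ᵐ X,
    (X ∈ criticalRegion n f θ k ↔ k < (orbitRatio n f θ X).toReal) ∧
      (X ∈ boundaryRegion n f θ k ↔ (orbitRatio n f θ X).toReal = k) := by
  filter_upwards [ae_posDef_sampleCov hn, ae_orbitRatio_ne_top hn hzero h0 h1] with X hX htop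
  rw [criticalRegion_eq h0 h1, boundaryRegion_eq h0 h1]
  simp only [Set.mem_inter_iff, Set.mem_ofPred_eq, hX, true_and]
  refine ⟨ENNReal.ofReal_lt_iff_lt_toReal hk htop, fun h => ?_, fun h => ?_⟩
  · rw [h, ENNReal.toReal_ofReal hk]
  · rw [← h, ENNReal.ofReal_toReal htop]

/-- The ratio tests are most powerful invariant at their size, and essentially unique. -/
theorem ratioTest_mostPowerful {k γ : ℝ} (hk : 0 ≤ k) (hγ0 : 0 ≤ γ) (hγ1 : γ ≤ 1) {α : ℝ}
    (hα : ∫ X, ratioTest n f θ k γ X ∂(sampleLaw n f 0 0 1) = α) :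
    IsMostPowerfulInvariant f θ α (ratioTest n f θ k γ) ∧
      ∀ φ : (Fin n → Fin p → ℝ) → ℝ, IsMostPowerfulInvariant f θ α φ →
        (∀ᵐ X, X ∉ boundaryRegion n f θ k → φ X = (criticalRegion n f θ k).indicator 1 X) ∧
        (0 < k → ∫ X, φ X ∂(sampleLaw n f 0 0 1) = α) := by
  have hP := isProbabilityMeasure_sampleLaw (n := n) h0
  have hT := isInvariantTest_ratioTest hn h0 h1 k hγ0 hγ1
  have hreg := ae_mem_regions hn hzero h0 h1 hk
  have hdet : (1 : Matrix (Fin p) (Fin p) ℝ).det ≠ 0 := by simp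
  -- Under the null law at (0, I), the integral of an invariant test against the ratio is its power,
  -- so Neyman–Pearson compares powers.
  have key : ∀ ψ : (Fin n → Fin p → ℝ) → ℝ, IsInvariantTest ψ → HasLevel f α ψ → _ :=
    fun ψ hψ hlev => neymanPearson (P := sampleLaw n f 0 0 1)
      (integrable_orbitRatio hn hzero h0 h1) hk hT.measurable hT.nonneg hT.le_one
      hψ.measurable hψ.nonneg hψ.le_one
      ((sampleLaw_absolutelyContinuous h0).ae_le (hreg.mono fun X hX hlt =>
        ratioTest_of_mem_criticalRegion (hX.1.2 hlt)))
      ((sampleLaw_absolutelyContinuous h0).ae_le (hreg.mono fun X hX hlt => by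
        rw [ratioTest_of_notMem_boundaryRegion fun h => hlt.ne (hX.2.1 h),
          Set.indicator_of_notMem fun h => hlt.not_gt (hX.1.1 h)]))
      ((hlev 0 1 hdet).trans hα.ge)
  have hTlev : HasLevel f α (ratioTest n f θ k γ) := fun a B hB => by
    rw [hT.integral_sampleLaw h0 a hB, hα]
  refine ⟨⟨hT, hTlev, fun ψ hψ hlev a B hB => ?_⟩, fun φ hφ => ?_⟩
  · rw [hψ.integral_sampleLaw h1 a hB, hT.integral_sampleLaw h1 a hB,
      hψ.integral_eq hn hzero h0 h1, hT.integral_eq hn hzero h0 h1]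
    exact (key ψ hψ hlev).1
  · have hpow := hφ.most_powerful _ hT hTlev 0 1 hdet
    rw [hφ.isInvariantTest.integral_eq hn hzero h0 h1, hT.integral_eq hn hzero h0 h1] at hpow
    obtain ⟨hu1, hu2⟩ := (key φ hφ.isInvariantTest hφ.hasLevel).2 hpow
    refine ⟨?_, fun hkpos => (hu2 hkpos).trans hα⟩
    filter_upwards [(volume_absolutelyContinuous_sampleLaw hzero h0).ae_le hu1, hreg]
      with X hX hreg hb
    rw [hX fun h => hb (hreg.2.2 h), ratioTest_of_notMem_boundaryRegion hb]

omit hn hzero in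
theorem integral_ratioTest (k γ : ℝ) :
    ∫ X, ratioTest n f θ k γ X ∂(sampleLaw n f 0 0 1)
      = (sampleLaw n f 0 0 1).real (criticalRegion n f θ k)
        + γ * (sampleLaw n f 0 0 1).real (boundaryRegion n f θ k) := by
  have hP := isProbabilityMeasure_sampleLaw (n := n) h0
  have hc := measurableSet_criticalRegion (n := n) h0 h1 k
  have hb := measurableSet_boundaryRegion (n := n) h0 h1 k
  have ic : Integrable ((criticalRegion n f θ k).indicator (1 : (Fin n → Fin p → ℝ) → ℝ))
      (sampleLaw n f 0 0 1) := (integrable_const (1 : ℝ)).indicator hc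
  have ib : Integrable ((boundaryRegion n f θ k).indicator (1 : (Fin n → Fin p → ℝ) → ℝ))
      (sampleLaw n f 0 0 1) := (integrable_const (1 : ℝ)).indicator hb
  unfold ratioTest
  rw [integral_add ic (ib.const_mul γ), integral_const_mul, integral_indicator_one hc,
    integral_indicator_one hb]

/-- Uniqueness extends to the boundary because the indicator is 0 there: a competitor dominates it
almost everywhere and, as k > 0, has the same size, so the two agree. -/
theorem criticalRegion_mostPowerful {k : ℝ} (hk : 0 < k) :
    IsMostPowerfulInvariant f θ ((sampleLaw n f 0 0 1).real (criticalRegion n f θ k))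
        ((criticalRegion n f θ k).indicator 1) ∧
      ∀ φ : (Fin n → Fin p → ℝ) → ℝ,
        IsMostPowerfulInvariant f θ ((sampleLaw n f 0 0 1).real (criticalRegion n f θ k)) φ →
        φ =ᵐ[volume] (criticalRegion n f θ k).indicator 1 := by
  have hP := isProbabilityMeasure_sampleLaw (n := n) h0
  have hc := measurableSet_criticalRegion (n := n) h0 h1 k
  have heq : ratioTest n f θ k 0 = (criticalRegion n f θ k).indicator 1 := by
    funext X
    simp [ratioTest]
  have hsize : ∫ X, ratioTest n f θ k 0 X ∂(sampleLaw n f 0 0 1)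
      = (sampleLaw n f 0 0 1).real (criticalRegion n f θ k) := by
    rw [integral_ratioTest h0 h1, zero_mul, add_zero]
  obtain ⟨hmp, huniq⟩ := ratioTest_mostPowerful hn hzero h0 h1 hk.le le_rfl zero_le_one hsize
  rw [heq] at hmp
  refine ⟨hmp, fun φ hφ => ?_⟩
  obtain ⟨hu1, hu2⟩ := huniq φ hφ
  have hT := hφ.isInvariantTest
  have iφ := integrable_of_mem_unitInterval (P := sampleLaw n f 0 0 1) hT.measurable hT.nonneg
    hT.le_one
  have ic : Integrable ((criticalRegion n f θ k).indicator (1 : (Fin n → Fin p → ℝ) → ℝ))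
      (sampleLaw n f 0 0 1) := (integrable_const (1 : ℝ)).indicator hc
  have hle : (criticalRegion n f θ k).indicator 1 ≤ᵐ[sampleLaw n f 0 0 1] φ := by
    refine (sampleLaw_absolutelyContinuous h0).ae_le (hu1.mono fun X hX => ?_)
    by_cases hb : X ∈ boundaryRegion n f θ k
    · rw [Set.indicator_of_notMem
        (Set.disjoint_right.1 (disjoint_criticalRegion_boundaryRegion k) hb)]
      exact hT.nonneg X
    · exact (hX hb).ge
  have h := (integral_eq_iff_of_ae_le ic iφ hle).1 (by
    rw [hu2 hk, integral_indicator_one hc])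
  exact (Filter.EventuallyEq.symm ((volume_absolutelyContinuous_sampleLaw hzero h0).ae_le h))

theorem exists_ratioTest_mostPowerful {α : ℝ} (hα0 : 0 < α) (hα1 : α < 1) :
    ∃ k γ : ℝ, 0 ≤ k ∧ ((∀ x, 0 < f θ x) → 0 < k) ∧ 0 ≤ γ ∧ γ ≤ 1 ∧
      ∫ X, ratioTest n f θ k γ X ∂(sampleLaw n f 0 0 1) = α := by
  have hP := isProbabilityMeasure_sampleLaw (n := n) h0
  obtain ⟨k, γ, hk, hkpos, hγ0, hγ1, hsize⟩ := exists_threshold (P := sampleLaw n f 0 0 1)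
    (measurable_orbitRatio (n := n) h0 h1).ennreal_toReal (fun _ => ENNReal.toReal_nonneg) hα0 hα1
  have hreg := (sampleLaw_absolutelyContinuous h0).ae_le (ae_mem_regions hn hzero h0 h1 hk)
  refine ⟨k, γ, hk, fun hpos => hkpos ?_, hγ0, hγ1, ?_⟩
  -- A positive density at θ makes the numerator nonzero, so the ratio is almost everywhere
  -- positive.
  · refine (sampleLaw_absolutelyContinuous h0).ae_le ?_
    filter_upwards [ae_orbitIntegral_zero hn hzero h0, ae_orbitRatio_ne_top hn hzero h0 h1]
      with X hX htop
    exact ENNReal.toReal_pos (ENNReal.div_ne_zero.2 ⟨orbitIntegral_ne_zero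
      (measurable_sampleDensity h1.measurable) (sampleDensity_ne_zero hpos) X, hX.2⟩) htop
  · rw [integral_ratioTest h0 h1, ← hsize]
    congr 1
    · exact measureReal_congr (Filter.Eventually.mono hreg fun X hX => propext hX.1)
    · congr 1
      exact measureReal_congr (Filter.Eventually.mono hreg fun X hX => propext hX.2)

end

/-! ### The main theorem -/

theorem proposition2 (n p : ℕ) (hn : p + 1 ≤ n) (f : ℝ → (Fin p → ℝ) → ℝ)
    (hf_meas : ∀ θ, 0 ≤ θ → Measurable (f θ))
    (hf_nonneg : ∀ θ, 0 ≤ θ → ∀ x, 0 ≤ f θ x)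
    (hf_int : ∀ θ, 0 ≤ θ → ∫⁻ x, ENNReal.ofReal (f θ x) = 1)
    (hf_zero : f 0 = stdNormalDensity p)
    (θ₁ : ℝ) (hθ₁ : 0 < θ₁) :
    -- the ratio is well defined almost everywhere
    (∀ᵐ X : Fin n → Fin p → ℝ, (sampleCov X).PosDef ∧
      groupIntegral f θ₁ (standardized X) ≠ ∞) ∧
    (∀ X : Fin n → Fin p → ℝ, (sampleCov X).PosDef →
      groupIntegral f 0 (standardized X) ≠ 0 ∧ groupIntegral f 0 (standardized X) ≠ ∞) ∧
    -- every region `ratio > k` is most powerful invariant at its size, and is the only such test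
    (∀ k : ℝ, 0 < k →
      IsMostPowerfulInvariant f θ₁ ((sampleLaw n f 0 0 1).real (criticalRegion n f θ₁ k))
        ((criticalRegion n f θ₁ k).indicator 1) ∧
      ∀ φ : (Fin n → Fin p → ℝ) → ℝ,
        IsMostPowerfulInvariant f θ₁ ((sampleLaw n f 0 0 1).real (criticalRegion n f θ₁ k)) φ →
        φ =ᵐ[volume] (criticalRegion n f θ₁ k).indicator 1) ∧
    -- at every level some `ratio > k`, randomized on `ratio = k`, is most powerful invariant,
    -- and every most powerful invariant test coincides with it off the boundary `ratio = k`
    (∀ α : ℝ, 0 < α → α < 1 → ∃ k γ : ℝ, 0 ≤ k ∧ ((∀ x, 0 < f θ₁ x) → 0 < k) ∧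
      0 ≤ γ ∧ γ ≤ 1 ∧
      ∫ X, ((criticalRegion n f θ₁ k).indicator 1 X
        + γ * (boundaryRegion n f θ₁ k).indicator 1 X) ∂(sampleLaw n f 0 0 1) = α ∧
      IsMostPowerfulInvariant f θ₁ α (fun X : Fin n → Fin p → ℝ =>
        (criticalRegion n f θ₁ k).indicator 1 X
          + γ * (boundaryRegion n f θ₁ k).indicator 1 X) ∧
      ∀ φ : (Fin n → Fin p → ℝ) → ℝ, IsMostPowerfulInvariant f θ₁ α φ →
        ∀ᵐ X : Fin n → Fin p → ℝ, X ∉ boundaryRegion n f θ₁ k →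
          φ X = (criticalRegion n f θ₁ k).indicator 1 X) := by
  have hd : ∀ θ, 0 ≤ θ → IsProbDensity (f θ) := fun θ hθ =>
    ⟨hf_meas θ hθ, hf_nonneg θ hθ, hf_int θ hθ⟩
  have h0 := hd 0 le_rfl
  have h1 := hd θ₁ hθ₁.le
  have hv1 := measurable_sampleDensity (n := n) h1.measurable
  refine ⟨?_, fun X hX => ?_, fun k hk => criticalRegion_mostPowerful hn hf_zero h0 h1 hk,
    fun α hα0 hα1 => ?_⟩
  · filter_upwards [ae_posDef_sampleCov hn, ae_orbitIntegral_ne_top hn hf_zero h0 h1] with X hX htop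
    refine ⟨hX, ?_⟩
    rw [groupIntegral_eq_orbitIntegral h1.nonneg, orbitIntegral_standardized hv1 hX]
    exact ENNReal.mul_ne_top (detWeight_ne_top _ _) htop
  · have hn0 : n ≠ 0 := by omega
    have hpos : (sampleCov (standardized X)).PosDef := by
      rw [sampleCov_standardized hn0 hX]
      exact Matrix.PosDef.one
    rw [groupIntegral_eq_orbitIntegral h0.nonneg, hf_zero]
    exact orbitIntegral_stdNormal hn (hf_zero ▸ h0) hpos
  · obtain ⟨k, γ, hk, hkpos, hγ0, hγ1, hsize⟩ :=
      exists_ratioTest_mostPowerful hn hf_zero h0 h1 hα0 hα1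
    obtain ⟨hmp, huniq⟩ := ratioTest_mostPowerful hn hf_zero h0 h1 hk hγ0 hγ1 hsize
    exact ⟨k, γ, hk, hkpos, hγ0, hγ1, hsize, hmp, fun φ hφ => (huniq φ hφ).1⟩
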